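/- Let $n\ge 3$ be an integer. Let $\boldsymbol\ell=\{\ell_{ij}=\ell_{ji} : 0\le i<j\le n\}$ be $\binom{n+1}{2}$ independent variables (the edge lengths of an $n$-simplex with vertices $0,\dots,n$; put $\ell_{ii}=0$), and let $\mathbb F$ be the algebraic closure of the field $\mathbb Q(\boldsymbol\ell)$ of rational functions. For a set of vertices $i_0<\dots<i_k$, let the square of the $k$-volume of the face that they span be given by the Cayley–Menger formula $$S_{i_0\ldots i_k}=\frac{(-1)^{k+1}}{2^k(k!)^2}\det\begin{pmatrix}0&1&\cdots&1\\ 1&\ell_{i_0i_0}^2&\cdots&\ell_{i_0i_k}^2\\ \vdots&\vdots&&\vdots\\ 1&\ell_{i_ki_0}^2&\cdots&\ell_{i_ki_k}^2\end{pmatrix}\in\mathbb Q[\boldsymbol\ell],$$ and let the $k$-volume $A_{i_0\ldots i_k}=\sqrt{S_{i_0\ldots i_k}}\in\mathbb F$ be a square root of it (the choice of signs does not matter). Let $V=A_{01\ldots n}$ be the volume of the simplex, and let $R_2\subset\mathbb F$ be the $\mathbb Q$-subalgebra generated by the areas $A_{ijk}$, $0\le i<j<k\le n$, of its $2$-faces.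 Then $V$ is integral over $R_2$ if and only if $n$ is even and $n\ge 6$. In other words, there is a monic relation $$V^N+a_1(\boldsymbol A)V^{N-1}+\dots+a_N(\boldsymbol A)=0$$ in $\mathbb F$, whose coefficients $a_1,\dots,a_N$ are polynomials with rational coefficients in the $2$-face areas $\boldsymbol A=(A_{ijk})$, if and only if $n$ is even and $n\ge 6$. -/

import Mathlib

noncomputable section

namespace SimplexVolume

/-- The edges of an `n`-simplex with vertices `0, …, n`: unordered pairs of distinct vertices. -/
abbrev Edge (n : ℕ) : Type := {e : Sym2 (Fin (n + 1)) // ¬ e.IsDiag}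

/-- The polynomial ring `ℚ[ℓ]` in the `(n + 1).choose 2` independent edge lengths. -/
abbrev LengthRing (n : ℕ) : Type := MvPolynomial (Edge n) ℚ

/-- The field `𝔽`, the algebraic closure of the field `ℚ(ℓ)` of rational functions in the
edge lengths. -/
abbrev LengthField (n : ℕ) : Type := AlgebraicClosure (FractionRing (LengthRing n))

/-- The edge length `ℓ i j = ℓ j i`: an independent variable for `i ≠ j`, and zero for `i = j`. -/
def len {n : ℕ} (i j : Fin (n + 1)) : LengthRing n :=
  if h : i = j then 0 else MvPolynomial.X ⟨s(i, j), fun hd => h (Sym2.mk_isDiag_iff.mp hd)⟩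

/-- The `k`-dimensional faces of an `n`-simplex, given by their sets of `k + 1` vertices. -/
abbrev Face (n k : ℕ) : Type := {s : Finset (Fin (n + 1)) // s.card = k + 1}

/-- The Cayley–Menger matrix of a face: the matrix of squared edge lengths, bordered by a row and
a column of ones with a zero in the corner. -/
def cayleyMengerMatrix {n k : ℕ} (F : Face n k) :
    Matrix (Option F.1) (Option F.1) (LengthRing n)
  | none, none => 0
  | none, some _ => 1
  | some _, none => 1
  | some i, some j => len i.1 j.1 ^ 2

/-- The square of the `k`-volume of a `k`-face, by the Cayley–Menger formula. -/
def volumeSq {n k : ℕ} (F : Face n k) : LengthRing n :=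
  MvPolynomial.C ((-1) ^ (k + 1) / (2 ^ k * (k.factorial : ℚ) ^ 2)) *
    (cayleyMengerMatrix F).det

theorem exists_volume {n k : ℕ} (F : Face n k) :
    ∃ a : LengthField n, a ^ 2 = algebraMap (LengthRing n) (LengthField n) (volumeSq F) :=
  IsAlgClosed.exists_pow_nat_eq _ two_pos

/-- The `k`-volume of a `k`-face as an element of `𝔽`: a square root of `volumeSq F`.
(Neither the algebra generated by volumes of faces nor integrality of a volume depends on the
signs of the roots.) -/
def volume {n k : ℕ} (F : Face n k) : LengthField n := Classical.choose (exists_volume F)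

theorem volume_sq {n k : ℕ} (F : Face n k) :
    volume F ^ 2 = algebraMap (LengthRing n) (LengthField n) (volumeSq F) :=
  Classical.choose_spec (exists_volume F)

/-- The volume `V` of the `n`-simplex itself. -/
def simplexVolume (n : ℕ) : LengthField n :=
  volume (⟨Finset.univ, by simp⟩ : Face n n)

/-- The `ℚ`-subalgebra `R_k` of `𝔽` generated by the `k`-volumes of all `k`-faces. -/
def faceAlgebra (n k : ℕ) : Subalgebra ℚ (LengthField n) :=
  Algebra.adjoin ℚ (Set.range fun F : Face n k => volume F)

end SimplexVolume

end

/-!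
# Integrality of the volume of a simplex over the areas of its two-dimensional faces

**Even `n ≥ 6`.** The integral closure of a ring in a field is the intersection of the valuation
rings containing it, so it has to be shown that a valuation ring `A` containing all areas contains
the volume (`simplexVolume_mem`).  Let `x i j` be the squared edge lengths.  If all of them lie in
`A`, there is nothing to do.  Otherwise take an edge `u v` with `x u v` of largest value and
rescale so that it has length one: now all squared edge lengths lie in `A`, and all squared areas
vanish modulo `η ^ 2`, where `η = (x u v)⁻¹`.  Let `q i` be the projection of the vertex `i` to the
line `u v`, and `f` the Gram matrix, of size `n - 1`, of the components orthogonal to this line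
(`EdgeCoordinates`).  Row operations on the Cayley–Menger matrix reduce the claim to
`η ^ n ∣ det f` (`NearDegenerate.pow_dvd_det`), in which only areas are used
(`NearDegenerate`).

* If `η` divides `f`, the areas of the triangles containing `u` or `v` show that `η ^ 2` divides
  `f k l` unless one of `k`, `l` is close to `u` and the other close to `v`.  Since `n - 1` is odd,
  one of the two groups of vertices is smaller, and taking `η` out of the rows and columns outside
  of it suffices (`NearDegenerate.pow_dvd_det_of_dvd`).  For odd `n` the two groups may have equal
  size, and this is where the statement fails.
* Otherwise let `s = f a b` be an entry that divides all others, `η = s θ`, `f = s g`.  Then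
  `u, v, a, b` is close to a quadruple with equal opposite edges and degenerate triangles, every
  vertex is close to one of these four (`PseudoQuad.exists_near`), and `g` is known up to small
  errors (`PseudoQuad.same_side`, `PseudoQuad.cross_side`).  After elimination with the pivots `a`
  and `b`, weights are taken out of rows and columns as before; `n ≥ 6` is needed here.

**Other `n`.** A specialization of the edge lengths to rational functions in `X` with polynomial
squared areas and non-polynomial squared volume contradicts integrality
(`not_isIntegral_simplexVolume`), because polynomial rings are integrally closed.  For odd `n` the
vertices are divided into two groups of equal size, with zero lengths inside each group
(`twoGroups`); for `n = 4` a degenerate quadruple with a doubled vertex is used (`doubledQuad`).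
-/

noncomputable section

namespace SimplexVolume

/-! ### Divisibility in a valuation ring -/

section Divisibility

variable {R : Type*} [CommRing R]

theorem dvd_comb {d x y z : R} (hx : d ∣ x) (hy : d ∣ y) (a b : R) (h : z = a * x + b * y) :
    d ∣ z :=
  h ▸ dvd_add (hx.mul_left a) (hy.mul_left b)

theorem isUnit_of_dvd_sub [IsLocalRing R] {d a b : R} (hd : ¬ IsUnit d) (ha : IsUnit a)
    (h : d ∣ a - b) : IsUnit b := by
  have h' : IsUnit (b + (a - b)) := by rwa [add_sub_cancel]
  exact (IsLocalRing.isUnit_or_isUnit_of_isUnit_add h').resolve_right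
    fun hu => hd (isUnit_of_dvd_unit h hu)

theorem isUnit_add_of_not_isUnit [IsLocalRing R] {x u : R} (hx : ¬ IsUnit x) (hu : IsUnit u) :
    IsUnit (x + u) :=
  isUnit_of_dvd_sub hx hu ⟨-1, by ring⟩

end Divisibility

/-! ### Determinants -/

section Determinant

open Matrix

variable {R ι : Type*} [CommRing R] [Fintype ι] [DecidableEq ι]

/-- If `w i * w j` divides the `(i, j)` entry of a matrix, then it can be taken out of the
rows and columns. -/
theorem prod_sq_dvd_det (M : Matrix ι ι R) (w : ι → R) (h : ∀ i j, w i * w j ∣ M i j) :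
    (∏ i, w i) ^ 2 ∣ M.det := by
  choose N hN using h
  have : M = of fun i j => w i * (of fun i j => w j * of N i j) i j := by
    ext i j
    simp [hN, mul_assoc]
  rw [this, det_mul_column, det_mul_row]
  exact ⟨(of N).det, by ring⟩

/-- Subtracting multiples of the row and of the column of a pivot `p`, with the same
coefficients, does not change the determinant. -/
theorem det_sub_pivot (M : Matrix ι ι R) (p : ι) (c : ι → R) (hc : c p = 0) :
    (of fun k l => M k l - c k * M p l - c l * M k p + c k * c l * M p p).det = M.det := by
  have h1 : (of fun k l => M k l - c k * M p l).det = M.det := by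
    refine det_eq_of_forall_row_eq_smul_add_const (fun k => -c k) p (by simp [hc]) fun k l => ?_
    simp only [of_apply]; ring
  rw [← h1, ← det_transpose, ← det_transpose (of fun k l => M k l - c k * M p l)]
  refine det_eq_of_forall_row_eq_smul_add_const (fun k => -c k) p (by simp [hc]) fun k l => ?_
  simp only [of_apply, transpose_apply]; ring

end Determinant

/-! ### Nearly degenerate configurations over a valuation ring -/

/-- The expression `2 (ab + bc + ca) - a² - b² - c²`: it is `16` times the squared area of the
triangle whose squared edge lengths are `a`, `b`, `c`. -/
def heron {R : Type*} [CommRing R] (a b c : R) : R :=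
  2 * (a * b + b * c + c * a) - a ^ 2 - b ^ 2 - c ^ 2

/-- Two points `0` and `1` of a line, and further points `k` with orthogonal projection `q k` to
that line; `f` is the Gram matrix of the components of the points orthogonal to the line.  The
conditions say that the squared areas of all triangles formed by the points
(including `0` and `1`) vanish modulo `ε`. -/
structure NearDegenerate {R ι : Type*} [CommRing R] (ε : R) (q : ι → R) (f : ι → ι → R) :
    Prop where
  symm : ∀ k l, f k l = f l k
  diag : ∀ k, ε ∣ f k k
  left : ∀ k l, ε ∣ f k l * (f k l + 2 * (q k * q l))
  right : ∀ k l, ε ∣ f k l * (f k l + 2 * ((1 - q k) * (1 - q l)))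
  triple : ∀ k l m, ε ∣ 2 * ((q m - q l) * (q k - q m) * f k l +
    (q k - q m) * (q l - q k) * f l m + (q l - q k) * (q m - q l) * f k m) +
      heron (f k l) (f l m) (f k m)

/-- A nearly degenerate configuration whose Gram matrix `s • g` is not small: its largest entry
`s` is in the position `(a, b)`, and areas vanish modulo `(s * θ) ^ 2` with `θ` in the maximal
ideal.  Then the points `0`, `1`, `a`, `b` form, up to a small error, a quadruple with
equal opposite edges all of whose triangles are degenerate.  The conditions of `NearDegenerate` for
`s • g` are divided by `s`.  The fields `unit_a` and `unit_b` fix the order of `a` and `b`: the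
point `a` projects away from the end point `1`, and `b` away from `0`. -/
structure PseudoQuad {R ι : Type*} [CommRing R] (s θ : R) (q : ι → R) (g : ι → ι → R)
    (a b : ι) : Prop where
  two : IsUnit (2 : R)
  three : IsUnit (3 : R)
  ne_zero : s ≠ 0
  small : ¬ IsUnit θ
  symm : ∀ k l, g k l = g l k
  diag : ∀ k, s * θ ^ 2 ∣ g k k
  left : ∀ k l, s * θ ^ 2 ∣ g k l * (s * g k l + 2 * (q k * q l))
  right : ∀ k l, s * θ ^ 2 ∣ g k l * (s * g k l + 2 * ((1 - q k) * (1 - q l)))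
  triple : ∀ k l m, s * θ ^ 2 ∣ 2 * ((q m - q l) * (q k - q m) * g k l +
    (q k - q m) * (q l - q k) * g l m + (q l - q k) * (q m - q l) * g k m) +
      s * heron (g k l) (g l m) (g k m)
  one : g a b = 1
  unit_a : IsUnit (1 - q a)
  unit_b : IsUnit (q b)

/-- The point `k` is near the end point `0` of the line (for `e = 0`) or near the point `a`
(for `e = 1`).  With `1 - q` for `q` and with `a` and `b` exchanged, this says that `k` is near the
end point `1` or near `b`. -/
structure Near {R ι : Type*} [CommRing R] (s θ : R) (q : ι → R) (g : ι → ι → R)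
    (a b k : ι) (e : R) : Prop where
  pos : s * θ ^ 2 ∣ q k - e * q a
  fst : s * θ ^ 2 ∣ g a k
  snd : θ ^ 2 ∣ g b k - e
  zero_or_one : e = 0 ∨ e = 1

namespace PseudoQuad

variable {R ι : Type*} [CommRing R] {s θ : R} {q : ι → R} {g : ι → ι → R} {a b : ι}

/-- The symmetry that exchanges the two end points of the line and the points `a` and `b`. -/
theorem swap (h : PseudoQuad s θ q g a b) : PseudoQuad s θ (fun k => 1 - q k) g b a where
  two := h.two
  three := h.three
  ne_zero := h.ne_zero
  small := h.small
  symm := h.symm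
  diag := h.diag
  left := h.right
  right k l := by simpa using h.left k l
  triple k l m := by
    have := h.triple k l m
    convert this using 1
    ring
  one := by rw [h.symm, h.one]
  unit_a := by simpa using h.unit_b
  unit_b := h.unit_a

theorem not_isUnit_sq (h : PseudoQuad s θ q g a b) : ¬ IsUnit (θ ^ 2) :=
  fun hu => h.small (isUnit_pow_iff two_ne_zero |>.mp hu)

theorem not_isUnit (h : PseudoQuad s θ q g a b) : ¬ IsUnit (s * θ ^ 2) :=
  fun hu => h.not_isUnit_sq (isUnit_of_mul_isUnit_right hu)

/-- A large Gram entry forces its two points to be symmetric about the midpoint of the line. -/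
theorem balance (h : PseudoQuad s θ q g a b) (k l : ι) :
    s * θ ^ 2 ∣ g k l * (q k + q l - 1) := by
  rw [← h.two.dvd_mul_left]
  exact dvd_comb (h.left k l) (h.right k l) 1 (-1) (by ring)

theorem left_ab (h : PseudoQuad s θ q g a b) : s * θ ^ 2 ∣ s + 2 * (q a * q b) := by
  simpa [h.one] using h.left a b

theorem balance_ab (h : PseudoQuad s θ q g a b) : s * θ ^ 2 ∣ q a + q b - 1 := by
  simpa [h.one] using h.balance a b

theorem not_isUnit_of_dvd (h : PseudoQuad s θ q g a b) {x : R} (hx : θ ^ 2 ∣ x) : ¬ IsUnit x :=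
  fun hu => h.not_isUnit_sq (isUnit_of_dvd_unit hx hu)

/-- The area of the triangle `a b k`, for a point `k` near neither `a` nor `b`: it locates the
projection of `k` near one of the two end points. -/
theorem triple_ab (h : PseudoQuad s θ q g a b) {k : ι} (hα : θ ^ 2 ∣ g a k)
    (hβ : θ ^ 2 ∣ g b k) : s * θ ^ 2 ∣ q k * (1 - q k) +
      (q b - q a) * ((q k - q b) * g a k + (q a - q k) * g b k) := by
  obtain ⟨x, hx⟩ := hα
  obtain ⟨y, hy⟩ := hβ
  obtain ⟨t, ht⟩ := h.triple a b k
  obtain ⟨w, hw⟩ := h.left_ab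
  obtain ⟨z, hz⟩ := h.balance_ab
  rw [← h.two.dvd_mul_left]
  rw [heron, h.one] at ht
  refine ⟨t - (2 * (x + y + g a k * y) - g a k * x - g b k * y) + w - 2 * q k * z, ?_⟩
  linear_combination ht + hw - 2 * q k * hz - s * (2 - g a k) * hx -
    s * (2 + 2 * g a k - g b k) * hy

theorem near_a (h : PseudoQuad s θ q g a b) : Near s θ q g a b a 1 where
  pos := by simp
  fst := h.diag a
  snd := by simp [h.symm b a, h.one]
  zero_or_one := Or.inr rfl

theorem not_near_a (h : PseudoQuad s θ q g a b) {e : R} :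
    ¬ Near s θ (fun k => 1 - q k) g b a a e := fun hn =>
  h.not_isUnit (isUnit_of_dvd_one (by simpa [h.symm b a, h.one] using hn.fst))

variable [IsDomain R]

/-- There is no regular triangle among the points at one and the same position on the line. -/
theorem no_triangle (h : PseudoQuad s θ q g a b) {k l m : ι} (hkl : θ ^ 2 ∣ g k l - 1)
    (hlm : θ ^ 2 ∣ g l m - 1) (hkm : θ ^ 2 ∣ g k m - 1) (h1 : s * θ ^ 2 ∣ q k - q l)
    (h2 : s * θ ^ 2 ∣ q l - q m) : False := by
  obtain ⟨x, hx⟩ := hkl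
  obtain ⟨y, hy⟩ := hlm
  obtain ⟨z, hz⟩ := hkm
  obtain ⟨v, hv⟩ := h1
  obtain ⟨w, hw⟩ := h2
  obtain ⟨t, ht⟩ := h.triple k l m
  have hx' : g k l = 1 + θ ^ 2 * x := by linear_combination hx
  have hy' : g l m = 1 + θ ^ 2 * y := by linear_combination hy
  have hz' : g k m = 1 + θ ^ 2 * z := by linear_combination hz
  have e1 : q k - q m = s * θ ^ 2 * (v + w) := by linear_combination hv + hw
  have e2 : q m - q l = - (s * θ ^ 2 * w) := by linear_combination -hw
  have e3 : q l - q k = - (s * θ ^ 2 * v) := by linear_combination -hv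
  rw [e1, e2, e3, hx', hy', hz', heron] at ht
  -- modulo `θ ^ 2`, the area condition divided by `s` reads `heron 1 1 1 = 3 = 0`
  refine h.not_isUnit_sq (isUnit_of_dvd_unit ?_ h.three)
  refine ⟨t - 2 * s * θ ^ 2 * (-w * (v + w) * (1 + θ ^ 2 * x) - v * (v + w) * (1 + θ ^ 2 * y)
    + v * w * (1 + θ ^ 2 * z)) - 2 * (x + y + z) - θ ^ 2 *
      (2 * (x * y + y * z + z * x) - x ^ 2 - y ^ 2 - z ^ 2), ?_⟩
  exact mul_left_cancel₀ h.ne_zero (by linear_combination ht)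

variable [ValuationRing R]

/-- The point `a` is at the scale `s` from the end point `0`. -/
theorem exists_unit (h : PseudoQuad s θ q g a b) : ∃ w, IsUnit w ∧ q a = s * w := by
  obtain ⟨z, hz⟩ := h.left_ab
  obtain ⟨u, hu⟩ := h.two.mul h.unit_b
  have h1 : IsUnit (θ ^ 2 * z - 1) :=
    isUnit_of_dvd_sub h.not_isUnit_sq isUnit_one.neg ⟨-z, by ring⟩
  refine ⟨(θ ^ 2 * z - 1) * ↑u⁻¹, h1.mul u⁻¹.isUnit, ?_⟩
  have : q a * u = s * (θ ^ 2 * z - 1) := by rw [hu]; linear_combination hz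
  rw [← mul_assoc, ← this, mul_assoc, Units.mul_inv, mul_one]

/-- The entry between `a` and any point `k` is either small or close to `1`; in the latter case the
projection of `k` is close to that of `b`. -/
theorem small_or_near_one (h : PseudoQuad s θ q g a b) (k : ι) :
    θ ^ 2 ∣ g a k ∨ (θ ^ 2 ∣ g a k - 1 ∧ s * θ ^ 2 ∣ q k - q b) := by
  refine or_iff_not_imp_left.mpr fun hα => ?_
  obtain ⟨π, hπ⟩ := (ValuationRing.dvd_total _ _).resolve_left hα
  have hπu : ¬ IsUnit π := fun hu => hα (by
    obtain ⟨v, rfl⟩ := hu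
    exact ⟨↑v⁻¹, by rw [hπ, mul_assoc, Units.mul_inv, mul_one]⟩)
  -- `g a k` strictly divides `θ ^ 2`; cancelling it, both factors below become small
  have hα0 : g a k ≠ 0 := fun h0 => hα (h0 ▸ dvd_zero _)
  obtain ⟨z, hz⟩ := h.balance a k
  obtain ⟨y, hy⟩ := h.left a k
  obtain ⟨w, hw⟩ := h.left_ab
  obtain ⟨x, hx⟩ := h.balance_ab
  have hz' : q a + q k - 1 = s * π * z := mul_left_cancel₀ hα0 (by rw [hz, hπ]; ring)
  have hy' : s * g a k + 2 * (q a * q k) = s * π * y :=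
    mul_left_cancel₀ hα0 (by rw [hy, hπ]; ring)
  have key : g a k - 1 = π * (y - g a k * w - 2 * q a * (z - g a k * x)) :=
    mul_left_cancel₀ h.ne_zero (by
      linear_combination hy' - hw - 2 * q a * hz' + 2 * q a * hx +
        (-s * w + 2 * q a * s * x) * hπ)
  have hunit : IsUnit (g a k) :=
    isUnit_of_dvd_sub hπu isUnit_one ⟨_, by rw [← neg_sub, key, ← mul_neg]⟩
  obtain ⟨v, hv⟩ := hunit
  have hπ' : π = θ ^ 2 * ↑v⁻¹ := by
    rw [hπ, ← hv, mul_right_comm, Units.mul_inv, one_mul]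
  refine ⟨⟨_, by rw [key, hπ', mul_assoc]⟩, ↑v⁻¹ * z - x, ?_⟩
  linear_combination hz' - hx + s * z * hπ'

theorem isUnit_one_sub (h : PseudoQuad s θ q g a b) {k : ι} {e : R} (hk : Near s θ q g a b k e) :
    IsUnit (1 - q k) := by
  rcases hk.zero_or_one with rfl | rfl
  · exact isUnit_of_dvd_sub h.not_isUnit isUnit_one (by simpa using hk.pos)
  · exact isUnit_of_dvd_sub h.not_isUnit h.unit_a (by simpa using hk.pos)

/-- A small Gram entry between points away from the end point `1` is very small. -/
theorem dvd_of_not_isUnit (h : PseudoQuad s θ q g a b) {k l : ι} (hg : ¬ IsUnit (g k l))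
    (hk : IsUnit (1 - q k)) (hl : IsUnit (1 - q l)) : s * θ ^ 2 ∣ g k l := by
  have : IsUnit (s * g k l + 2 * ((1 - q k) * (1 - q l))) :=
    isUnit_add_of_not_isUnit (fun hu => hg (isUnit_of_mul_isUnit_right hu))
      (h.two.mul (hk.mul hl))
  exact this.dvd_mul_right.mp (h.right k l)

/-- If the entries of `k` look like those of `a`, then `k` is near `a`. -/
theorem near_one (h : PseudoQuad s θ q g a b) {k : ι} (hα : θ ^ 2 ∣ g a k)
    (hβ : θ ^ 2 ∣ g b k - 1) (hq : s * θ ^ 2 ∣ q k - q a) : Near s θ q g a b k 1 where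
  pos := by simpa using hq
  fst := h.dvd_of_not_isUnit (h.not_isUnit_of_dvd hα) h.unit_a
    (isUnit_of_dvd_sub h.not_isUnit h.unit_a (by simpa using hq))
  snd := hβ
  zero_or_one := Or.inr rfl

/-- If `k` has small entries with `a` and `b` and projects close to `0`, then `k` is near `0`. -/
theorem near_zero (h : PseudoQuad s θ q g a b) {k : ι} (hα : θ ^ 2 ∣ g a k)
    (hβ : θ ^ 2 ∣ g b k) (hq : ¬ IsUnit (q k)) : Near s θ q g a b k 0 := by
  have hk : IsUnit (1 - q k) := IsLocalRing.isUnit_one_sub_self_of_mem_nonunits _ hq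
  have hα' := h.dvd_of_not_isUnit (h.not_isUnit_of_dvd hα) h.unit_a hk
  refine ⟨?_, hα', by simpa using hβ, Or.inl rfl⟩
  obtain ⟨t, ht⟩ := h.triple_ab hα hβ
  obtain ⟨w, -, hw⟩ := h.exists_unit
  obtain ⟨x, hx⟩ := hα'
  obtain ⟨y, hy⟩ := hβ
  have hu : IsUnit (1 - q k - (q b - q a) * g b k) :=
    isUnit_of_dvd_sub h.not_isUnit_sq hk ⟨(q b - q a) * y, by rw [hy]; ring⟩
  rw [zero_mul, sub_zero, ← hu.dvd_mul_right]
  refine ⟨t - (q b - q a) * (q k - q b) * x - (q b - q a) * w * y, ?_⟩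
  linear_combination ht - (q b - q a) * (q k - q b) * hx - (q b - q a) * q a * hy -
    (q b - q a) * θ ^ 2 * y * hw

/-- Every point is near one of the four vertices `0`, `a`, `1`, `b` of the quadruple. -/
theorem exists_near (h : PseudoQuad s θ q g a b) (k : ι) :
    (∃ e, Near s θ q g a b k e) ∨ ∃ e, Near s θ (fun k => 1 - q k) g b a k e := by
  rcases h.small_or_near_one k with hα | ⟨hα, hqb⟩ <;>
    rcases h.swap.small_or_near_one k with hβ | ⟨hβ, hqa⟩
  · obtain ⟨x, hx⟩ := id hα
    obtain ⟨y, hy⟩ := id hβ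
    obtain ⟨t, ht⟩ := h.triple_ab hα hβ
    by_cases hq : IsUnit (q k)
    · refine Or.inr ⟨0, h.swap.near_zero hβ hα fun hu => ?_⟩
      refine h.not_isUnit_sq (isUnit_of_dvd_unit ?_ (hq.mul hu))
      refine ⟨s * t - (q b - q a) * ((q k - q b) * x + (q a - q k) * y), ?_⟩
      linear_combination ht - (q b - q a) * (q k - q b) * hx - (q b - q a) * (q a - q k) * hy
    · exact Or.inl ⟨0, h.near_zero hα hβ hq⟩
  · refine Or.inl ⟨1, h.near_one hα hβ ?_⟩
    exact (dvd_neg.mpr hqa).trans (by simp)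
  · refine Or.inr ⟨1, h.swap.near_one hβ hα ?_⟩
    exact (dvd_neg.mpr hqb).trans (by simp)
  · refine (h.no_triangle (k := a) (l := k) (m := b) hα ?_ ?_ ?_ hqb).elim
    · rwa [h.symm]
    · simp [h.one]
    · exact hqa.trans (by simp)

/-- Points on the same side have a very small Gram entry. -/
theorem same_side (h : PseudoQuad s θ q g a b) {k l : ι} {e e' : R}
    (hk : Near s θ q g a b k e) (hl : Near s θ q g a b l e') : s * θ ^ 2 ∣ g k l := by
  by_cases hg : IsUnit (g k l)
  · exfalso
    have hb : s * θ ^ 2 ∣ q k + q l - 1 := hg.dvd_mul_left.mp (h.balance k l)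
    have hkp := hk.pos
    have hlp := hl.pos
    have hks := hk.snd
    have hls := hl.snd
    rcases hk.zero_or_one with rfl | rfl
    · -- `q k` is about `0`, hence `q l` is about `1`, which is impossible for `l` on this side
      refine h.not_isUnit (isUnit_of_dvd_unit ?_ (h.isUnit_one_sub hl))
      exact dvd_comb hb hkp (-1) 1 (by ring)
    · rcases hl.zero_or_one with rfl | rfl
      · refine h.not_isUnit (isUnit_of_dvd_unit ?_ (h.isUnit_one_sub hk))
        exact dvd_comb hb hlp (-1) 1 (by ring)
      · -- both points, and `b` with them, are at the midpoint of the line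
        obtain ⟨x, hx⟩ := id hkp
        obtain ⟨y, hy⟩ := id hlp
        obtain ⟨z, hz⟩ := h.balance_ab
        obtain ⟨w, hw⟩ := id hb
        obtain ⟨t, ht⟩ := hg.dvd_mul_left.mp (h.left k l)
        obtain ⟨r, hr⟩ := h.left_ab
        have hbl : s * θ ^ 2 ∣ q b - q l := ⟨z + x - w, by linear_combination hz + hx - hw⟩
        refine h.no_triangle (k := b) (l := l) (m := k) hls ?_ hks hbl
          ⟨y - x, by linear_combination hy - hx⟩
        rw [h.symm]
        refine ⟨t - r - 2 * (q k * y + q a * x) + 2 * q a * (z - w + x + y), ?_⟩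
        refine mul_left_cancel₀ h.ne_zero ?_
        linear_combination ht - hr - 2 * q k * hy - 2 * q a * hx + 2 * q a * (hz - hw + hx + hy)
  · exact h.dvd_of_not_isUnit hg (h.isUnit_one_sub hk) (h.isUnit_one_sub hl)

/-- A point near `0` and a point near `b`: they are not symmetric about the midpoint. -/
theorem cross_zero_one (h : PseudoQuad s θ q g a b) {k l : ι} (hk : Near s θ q g a b k 0)
    (hl : Near s θ (fun k => 1 - q k) g b a l 1) : θ ^ 2 ∣ g k l := by
  obtain ⟨x, hx⟩ := hk.pos
  obtain ⟨y, hy⟩ := hl.pos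
  obtain ⟨z, hz⟩ := h.balance_ab
  obtain ⟨w, hw, hw'⟩ := h.exists_unit
  obtain ⟨t, ht⟩ := h.balance k l
  have hu : IsUnit (θ ^ 2 * (x - y + z) - w) :=
    isUnit_of_dvd_sub h.not_isUnit_sq hw.neg ⟨-(x - y + z), by ring⟩
  rw [← hu.dvd_mul_right]
  refine ⟨t, mul_left_cancel₀ h.ne_zero ?_⟩
  linear_combination ht - g k l * (hx - hy + hz - hw')

/-- Points near the two end points: the conditions from triangles with an end point only bound the
square of the entry, and the triangle with the vertex `a` is needed. -/
theorem cross_zero_zero (h : PseudoQuad s θ q g a b) {k l : ι} (hk : Near s θ q g a b k 0)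
    (hl : Near s θ (fun k => 1 - q k) g b a l 0) : θ ^ 2 ∣ g k l := by
  obtain ⟨x, hx⟩ := hk.pos
  obtain ⟨y, hy⟩ := hl.pos
  obtain ⟨w, hw, hw'⟩ := h.exists_unit
  obtain ⟨t, ht⟩ := h.left k l
  obtain ⟨r, hr⟩ := h.triple a k l
  obtain ⟨α, hα⟩ := hk.fst
  obtain ⟨β, hβ⟩ := hl.snd
  simp only [zero_mul, sub_zero] at hx hy hβ
  have hql : 1 - q l = s * θ ^ 2 * y := hy
  -- `2 (q l - q a) (q a - q k) / s` is a unit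
  have hu : IsUnit (2 * ((q l - q a) * (w - θ ^ 2 * x))) := by
    refine h.two.mul (IsUnit.mul ?_ ?_)
    · exact isUnit_of_dvd_sub h.not_isUnit h.unit_a ⟨y, by linear_combination hql⟩
    · exact isUnit_of_dvd_sub h.not_isUnit_sq hw ⟨x, by ring⟩
  have hsq : g k l ^ 2 = θ ^ 2 * (t - 2 * x * q l * g k l) :=
    mul_left_cancel₀ h.ne_zero (by linear_combination ht - 2 * q l * g k l * hx)
  have e : q k - q a = s * (θ ^ 2 * x - w) := by linear_combination hx - hw'
  rw [e, hα, hβ, heron] at hr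
  rw [← hu.dvd_mul_left]
  refine ⟨r - 2 * (q l - q k) * (q a - q l) * α - 2 * (θ ^ 2 * x - w) * (q l - q k) * β -
    (2 * (s * α * g k l + g k l * β + β * (s * θ ^ 2 * α)) - s * α * (s * θ ^ 2 * α) -
      (t - 2 * x * q l * g k l) - θ ^ 2 * β ^ 2), mul_left_cancel₀ h.ne_zero ?_⟩
  linear_combination hr + s * hsq

/-- Points near `a` and `b`: the entry is close to `0` or `1`, and the triangle with the vertex `a`
rules out `0`. -/
theorem cross_one_one (h : PseudoQuad s θ q g a b) {k l : ι} (hk : Near s θ q g a b k 1)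
    (hl : Near s θ (fun k => 1 - q k) g b a l 1) : θ ^ 2 ∣ g k l - 1 := by
  obtain ⟨x, hx⟩ := hk.pos
  obtain ⟨y, hy⟩ := hl.pos
  obtain ⟨w, hw⟩ := h.left_ab
  obtain ⟨t, ht⟩ := h.left k l
  simp only [one_mul] at hx hy
  have hg : θ ^ 2 ∣ g k l * (g k l - 1) := by
    refine ⟨t - g k l * (w + 2 * (q l * x - q a * y)), mul_left_cancel₀ h.ne_zero ?_⟩
    linear_combination ht - g k l * (hw + 2 * q l * hx - 2 * q a * hy)
  by_cases hu : IsUnit (g k l)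
  · exact hu.dvd_mul_left.mp hg
  · exfalso
    have hu' : IsUnit (g k l - 1) := by
      simpa [sub_eq_add_neg] using isUnit_add_of_not_isUnit hu isUnit_one.neg
    obtain ⟨z, hz⟩ := hu'.dvd_mul_right.mp hg
    obtain ⟨r, hr⟩ := h.triple a k l
    obtain ⟨α, hα⟩ := hk.fst
    obtain ⟨β, hβ⟩ := hl.snd
    have hβ' : g a l = 1 + θ ^ 2 * β := by linear_combination hβ
    have e : q k = q a + s * θ ^ 2 * x := by linear_combination hx
    rw [hα, hβ', hz, e, heron] at hr
    refine h.not_isUnit_sq (isUnit_of_dvd_one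
      ⟨-(r - 2 * (q l - (q a + s * θ ^ 2 * x)) * (q a - q l) * α -
        2 * x * (q a - q l) * θ ^ 2 * z -
        2 * x * (q l - (q a + s * θ ^ 2 * x)) * (1 + θ ^ 2 * β) -
        (2 * (s * θ ^ 2 * α * z + z * (1 + θ ^ 2 * β) + (1 + θ ^ 2 * β) * (s * α)) -
          s * α * (s * θ ^ 2 * α) - θ ^ 2 * z ^ 2 - 2 * β - θ ^ 2 * β ^ 2)), ?_⟩)
    exact mul_left_cancel₀ h.ne_zero (by linear_combination -hr)

/-- Points on different sides have a small Gram entry, unless they are near `a` and `b`. -/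
theorem cross_side (h : PseudoQuad s θ q g a b) {k l : ι} {e e' : R}
    (hk : Near s θ q g a b k e) (hl : Near s θ (fun k => 1 - q k) g b a l e') :
    θ ^ 2 ∣ g k l - e * e' := by
  rcases hk.zero_or_one with rfl | rfl <;> rcases hl.zero_or_one with rfl | rfl
  · simpa using h.cross_zero_zero hk hl
  · simpa using h.cross_zero_one hk hl
  · have := h.swap.cross_zero_one hl (by simpa using hk)
    rw [h.symm] at this
    simpa using this
  · simpa using h.cross_one_one hk hl

end PseudoQuad

/-! ### Elimination with two pivots -/

section PivotDeterminant

open Matrix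

variable {R ι : Type*} [CommRing R]

/-- The two sizes of the entries of a matrix whose index set is divided into two sides: entries
between indices on the same side have the first size, the others the second. -/
def sideSize (S : ι → Prop) [DecidablePred S] (x y : R) (k l : ι) : R :=
  if S k ↔ S l then x else y

/-- Elimination within one side preserves the sizes of the entries. -/
theorem sideSize_dvd_sub_pivot {S : ι → Prop} [DecidablePred S] {x y : R} {E : ι → ι → R}
    (hE : ∀ k l, sideSize S x y k l ∣ E k l) {p : ι} {c : ι → R}
    (hc : ∀ k, c k = 0 ∨ (S k ↔ S p)) (k l : ι) :
    sideSize S x y k l ∣ E k l - c k * E p l - c l * E k p + c k * c l * E p p := by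
  have h1 : sideSize S x y k l ∣ c k * E p l := by
    rcases hc k with h | h
    · simp [h]
    · have := hE p l
      simp only [sideSize, ← h] at this ⊢
      exact this.mul_left _
  have h2 : sideSize S x y k l ∣ c l * E k p := by
    rcases hc l with h | h
    · simp [h]
    · have := hE k p
      simp only [sideSize, ← h] at this ⊢
      exact this.mul_left _
  have h3 : sideSize S x y k l ∣ c k * c l * E p p := by
    rcases hc k with h | h
    · simp [h]
    · rcases hc l with h' | h'
      · simp [h']
      · have := hE p p
        simp only [sideSize, h, h'] at this ⊢
        exact this.mul_left _
  exact dvd_add (dvd_sub (dvd_sub (hE k l) h1) h2) h3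

/-- A matrix of the form `s (A Bᵀ + B Aᵀ) + E`, where `A` and `B` are supported on the two sides
of the index set and `E` is small, has a small determinant: after elimination with the
pivots `a` and `b`, row and column weights can be taken out. -/
theorem pow_mul_pow_dvd_det [Fintype ι] [DecidableEq ι] {S : ι → Prop} [DecidablePred S] {s θ : R}
    {f : ι → ι → R} {A B : ι → R} {a b : ι} (ha : S a) (hb : ¬ S b) (hAa : A a = 1) (hBb : B b = 1)
    (hA : ∀ k, A k = 0 ∨ S k) (hB : ∀ k, B k = 0 ∨ ¬ S k)
    (hE : ∀ k l, sideSize S (s ^ 2 * θ ^ 2) (s * θ ^ 2) k l ∣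
      f k l - s * (A k * B l + B k * A l)) :
    (s ^ (Finset.univ.filter S).card * θ ^ (Fintype.card ι - 2)) ^ 2 ∣ (of f).det := by
  have hAb : A b = 0 := (hA b).resolve_right hb
  have hBa : B a = 0 := (hB a).resolve_right (not_not.mpr ha)
  have hab : a ≠ b := fun h => hb (h ▸ ha)
  -- the multipliers for the pivots `a` and `b`, and the error terms after the two eliminations
  set c₁ : ι → R := fun k => if k = a then 0 else A k with hc₁
  set c₂ : ι → R := fun k => if k = b then 0 else B k with hc₂
  have e₁ : ∀ k, A k = c₁ k + if k = a then 1 else 0 := by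
    intro k; by_cases h : k = a <;> simp [hc₁, h, hAa]
  have e₂ : ∀ k, B k = c₂ k + if k = b then 1 else 0 := by
    intro k; by_cases h : k = b <;> simp [hc₂, h, hBb]
  have hc₁S : ∀ k, c₁ k = 0 ∨ (S k ↔ S a) := by
    intro k
    by_cases h : k = a
    · simp [h]
    · simpa [hc₁, h, ha] using hA k
  have hc₂S : ∀ k, c₂ k = 0 ∨ (S k ↔ S b) := by
    intro k
    by_cases h : k = b
    · simp [h]
    · simpa [hc₂, h, hb] using hB k
  set E₀ : ι → ι → R := fun k l => f k l - s * (A k * B l + B k * A l) with hE₀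
  set E₁ : ι → ι → R := fun k l =>
    E₀ k l - c₁ k * E₀ a l - c₁ l * E₀ k a + c₁ k * c₁ l * E₀ a a with hE₁
  set E₂ : ι → ι → R := fun k l =>
    E₁ k l - c₂ k * E₁ b l - c₂ l * E₁ k b + c₂ k * c₂ l * E₁ b b with hE₂
  have hE₂S : ∀ k l, sideSize S (s ^ 2 * θ ^ 2) (s * θ ^ 2) k l ∣ E₂ k l :=
    sideSize_dvd_sub_pivot (sideSize_dvd_sub_pivot hE hc₁S) hc₂S
  rw [← det_sub_pivot (of f) a c₁ (by simp [hc₁]), ← det_sub_pivot _ b c₂ (by simp [hc₂])]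
  set w : ι → R := fun k => (if S k then s else 1) * (if k = a ∨ k = b then 1 else θ) with hw
  have hprod : ∏ k, w k = s ^ (Finset.univ.filter S).card * θ ^ (Fintype.card ι - 2) := by
    have h2 : (Finset.univ.filter fun k => ¬ (k = a ∨ k = b)).card = Fintype.card ι - 2 := by
      have : (Finset.univ.filter fun k => ¬ (k = a ∨ k = b)) = ({a, b} : Finset ι)ᶜ := by
        ext k; simp
      rw [this, Finset.card_compl, Finset.card_pair hab]
    simp only [hw, Finset.prod_mul_distrib, Finset.prod_ite, Finset.prod_const, one_pow, mul_one,
      one_mul, h2]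
  rw [← hprod]
  refine prod_sq_dvd_det _ w fun k l => ?_
  have hθ : ∀ k, (if k = a ∨ k = b then 1 else θ) ∣ θ := fun k => by split_ifs <;> simp
  have hwE : w k * w l ∣ E₂ k l := by
    refine dvd_trans ?_ (hE₂S k l)
    have := mul_dvd_mul (hθ k) (hθ l)
    by_cases hk : S k <;> by_cases hl : S l <;> simp only [hw, sideSize, hk, hl, if_true, if_false,
      iff_true, iff_false, not_true]
    · convert mul_dvd_mul_left (s ^ 2) this using 1 <;> ring
    · convert mul_dvd_mul_left s this using 1 <;> ring
    · convert mul_dvd_mul_left s this using 1 <;> ring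
    · refine dvd_trans ?_ (Dvd.intro_left (s ^ 2) rfl)
      convert this using 1 <;> ring
  have hmain : w k * w l ∣ s * ((if k = a then 1 else 0) * (if l = b then 1 else 0) +
      (if k = b then 1 else 0) * (if l = a then 1 else 0)) := by
    by_cases hk : k = a ∧ l = b
    · obtain ⟨rfl, rfl⟩ := hk
      simp [hw, ha, hb]
    · by_cases hk' : k = b ∧ l = a
      · obtain ⟨rfl, rfl⟩ := hk'
        simp [hw, ha, hb]
      · have : (if k = a then (1 : R) else 0) * (if l = b then 1 else 0) +
            (if k = b then 1 else 0) * (if l = a then 1 else 0) = 0 := by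
          grind
        rw [this, mul_zero]
        exact dvd_zero _
  convert dvd_add hmain hwE using 1
  have hf : ∀ k l, f k l = s * (A k * B l + B k * A l) + E₀ k l := fun k l => by
    rw [hE₀]; ring
  simp only [of_apply, hf, hE₂, hE₁, hAa, hBb, hAb, hBa, e₁ k, e₁ l, e₂ k, e₂ l]
  have hc₁b : c₁ b = 0 := by simp [hc₁, hab.symm, hAb]
  simp only [hc₁b]
  ring

end PivotDeterminant

namespace PseudoQuad

open Matrix

variable {R ι : Type*} [CommRing R] [IsDomain R] [ValuationRing R] [Fintype ι] [DecidableEq ι]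
  {s θ : R} {q : ι → R} {g : ι → ι → R} {a b : ι}

/-- The Gram determinant in the presence of a pseudo-linear quadruple: elimination with the pivots
`a` and `b` leaves small entries only, and the parity of the number of points decides which side
receives the larger weight. -/
theorem pow_dvd_det (h : PseudoQuad s θ q g a b) {m : ℕ} (hm : 2 ≤ m)
    (hι : Fintype.card ι = 2 * m + 1) :
    (s * θ) ^ (2 * m + 2) ∣ (of fun k l => s * g k l).det := by
  classical
  have hex := h.exists_near
  set S : ι → Prop := fun k => ∃ e, Near s θ q g a b k e with hS
  have ha : S a := ⟨1, h.near_a⟩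
  have hb : ¬ S b := fun ⟨e, he⟩ => h.swap.not_near_a (e := e) (by simpa using he)
  have hS' : ∀ k, ¬ S k → ∃ e, Near s θ (fun k => 1 - q k) g b a k e :=
    fun k hk => (hex k).resolve_left hk
  set A : ι → R := fun k => if k = a then 1 else if hk : S k then hk.choose else 0 with hA
  set B : ι → R := fun k => if k = b then 1 else if hk : S k then 0 else (hS' k hk).choose with hB
  have hAS : ∀ k, S k → Near s θ q g a b k (A k) := fun k hk => by
    by_cases hka : k = a
    · simpa [hA, hka] using h.near_a
    · simpa [hA, hka, hk] using hk.choose_spec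
  have hBS : ∀ k, ¬ S k → Near s θ (fun k => 1 - q k) g b a k (B k) := fun k hk => by
    by_cases hkb : k = b
    · simpa [hB, hkb] using h.swap.near_a
    · simpa [hB, hkb, hk] using (hS' k hk).choose_spec
  have hA0 : ∀ k, A k = 0 ∨ S k := fun k => by
    by_cases hk : S k
    · exact Or.inr hk
    · exact Or.inl (by simp [hA, hk, show k ≠ a from fun e => hk (e ▸ ha)])
  have hB0 : ∀ k, B k = 0 ∨ ¬ S k := fun k => by
    by_cases hk : S k
    · exact Or.inl (by simp [hB, hk, show k ≠ b from fun e => hb (e ▸ hk)])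
    · exact Or.inr hk
  have hE : ∀ k l, sideSize S (s ^ 2 * θ ^ 2) (s * θ ^ 2) k l ∣
      s * g k l - s * (A k * B l + B k * A l) := by
    intro k l
    by_cases hk : S k <;> by_cases hl : S l
    · have := mul_dvd_mul_left s (h.same_side (hAS k hk) (hAS l hl))
      simpa [sideSize, hk, hl, (hB0 k).resolve_right (not_not.mpr hk),
        (hB0 l).resolve_right (not_not.mpr hl), sq, mul_assoc] using this
    · have := mul_dvd_mul_left s (h.cross_side (hAS k hk) (hBS l hl))
      simpa [sideSize, hk, hl, (hB0 k).resolve_right (not_not.mpr hk), mul_sub] using this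
    · have := mul_dvd_mul_left s (h.cross_side (hAS l hl) (hBS k hk))
      simpa [sideSize, hk, hl, (hB0 l).resolve_right (not_not.mpr hl), mul_sub, h.symm l k,
        mul_comm (A l)] using this
    · have := mul_dvd_mul_left s (h.swap.same_side (hBS k hk) (hBS l hl))
      simpa [sideSize, hk, hl, (hA0 k).resolve_right hk, (hA0 l).resolve_right hl,
        sq, mul_assoc] using this
  have hcard := Finset.card_filter_add_card_filter_not (s := (Finset.univ : Finset ι)) S
  rw [Finset.card_univ, hι] at hcard
  -- the total weight is `s ^ u * θ ^ (2 m - 1)`, where `u` counts the points with weight `s`;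
  -- the power of `θ` requires `2 ≤ m`, and `s` is put on the side with more points
  have key : ∀ u, m + 1 ≤ u → (s * θ) ^ (2 * m + 2) ∣
      (s ^ u * θ ^ (Fintype.card ι - 2)) ^ 2 := fun u hu => by
    rw [mul_pow, mul_pow, ← pow_mul, ← pow_mul]
    exact mul_dvd_mul (pow_dvd_pow _ (by omega)) (pow_dvd_pow _ (by omega))
  rcases le_or_gt (m + 1) (Finset.univ.filter S).card with hu | hu
  · exact (key _ hu).trans
      (pow_mul_pow_dvd_det ha hb (by simp [hA]) (by simp [hB]) hA0 hB0 hE)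
  · refine (key (Finset.univ.filter fun k => ¬ S k).card (by omega)).trans
      (pow_mul_pow_dvd_det (S := fun k => ¬ S k) (A := B) (B := A) hb (not_not.mpr ha)
        (by simp [hB]) (by simp [hA]) hB0 (fun k => by simpa using hA0 k) fun k l => ?_)
    have := hE k l
    simp only [sideSize, not_iff_not] at this ⊢
    convert this using 2
    ring

end PseudoQuad

/-! ### Gram determinants of nearly degenerate configurations -/

/-- In a valuation ring some entry of a nonempty finite table divides all the others. -/
theorem exists_dvd_all {R ι : Type*} [CommRing R] [IsDomain R] [ValuationRing R] [Fintype ι]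
    [Nonempty ι] (F : ι → ι → R) : ∃ a b, ∀ k l, F a b ∣ F k l := by
  classical
  have : ∀ t : Finset (ι × ι), t.Nonempty → ∃ p ∈ t, ∀ r ∈ t, F p.1 p.2 ∣ F r.1 r.2 := by
    intro t ht
    induction ht using Finset.Nonempty.cons_induction with
    | singleton p => exact ⟨p, by simp⟩
    | cons p t hp ht ih =>
      obtain ⟨r, hr, hrt⟩ := ih
      rcases ValuationRing.dvd_total (F p.1 p.2) (F r.1 r.2) with hd | hd
      · exact ⟨p, by simp, fun x hx => by
          rcases Finset.mem_cons.mp hx with rfl | hx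
          · exact dvd_rfl
          · exact hd.trans (hrt x hx)⟩
      · exact ⟨r, by simp [hr], fun x hx => by
          rcases Finset.mem_cons.mp hx with rfl | hx
          · exact hd
          · exact hrt x hx⟩
  obtain ⟨p, -, hp⟩ := this Finset.univ Finset.univ_nonempty
  exact ⟨p.1, p.2, fun k l => hp (k, l) (Finset.mem_univ _)⟩

namespace NearDegenerate

open Matrix

variable {R ι : Type*} [CommRing R] [IsDomain R] [ValuationRing R] {η : R} {q : ι → R}
  {f : ι → ι → R}

/-- If `f = s • g` has an entry `s` that divides all others but is not divisible by `η = s θ`,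
then up to an exchange of the indices of that entry there is a `PseudoQuad`. -/
theorem exists_pseudoQuad {s θ : R} {g : ι → ι → R}
    (h : NearDegenerate ((s * θ) ^ 2) q fun k l => s * g k l) (h2 : IsUnit (2 : R))
    (h3 : IsUnit (3 : R)) (hs : s ≠ 0) (hθ : ¬ IsUnit θ) {a b : ι} (hab : g a b = 1) :
    ∃ a b, PseudoQuad s θ q g a b := by
  have cancel : ∀ {x y : R}, (s * θ) ^ 2 ∣ x → x = s * y → s * θ ^ 2 ∣ y := by
    rintro x y ⟨z, rfl⟩ hz
    exact ⟨z, mul_left_cancel₀ hs (by linear_combination -hz)⟩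
  have symm : ∀ k l, g k l = g l k := fun k l => mul_left_cancel₀ hs (h.symm k l)
  have left : ∀ k l, s * θ ^ 2 ∣ g k l * (s * g k l + 2 * (q k * q l)) :=
    fun k l => cancel (h.left k l) (by ring)
  have right : ∀ k l, s * θ ^ 2 ∣ g k l * (s * g k l + 2 * ((1 - q k) * (1 - q l))) :=
    fun k l => cancel (h.right k l) (by ring)
  have build : ∀ {a b}, g a b = 1 → IsUnit (1 - q a) → IsUnit (q b) → PseudoQuad s θ q g a b :=
    fun hab ha hb =>
    { two := h2
      three := h3
      ne_zero := hs
      small := hθ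
      symm := symm
      diag := fun k => cancel (h.diag k) rfl
      left := left
      right := right
      triple := fun k l m => cancel (h.triple k l m) (by simp only [heron]; ring)
      one := hab
      unit_a := ha
      unit_b := hb }
  have hd : ¬ IsUnit (s * θ ^ 2) := fun hu =>
    hθ (isUnit_pow_iff two_ne_zero |>.mp (isUnit_of_mul_isUnit_right hu))
  have hbal : s * θ ^ 2 ∣ q a + q b - 1 := by
    have h1 := left a b
    have h1' := right a b
    rw [hab] at h1 h1'
    rw [← h2.dvd_mul_left]
    exact dvd_comb h1 h1' 1 (-1) (by ring)
  by_cases ha : IsUnit (1 - q a)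
  · exact ⟨a, b, build hab ha (isUnit_of_dvd_sub hd ha (by
      rw [← dvd_neg]; convert hbal using 1; ring))⟩
  · have ha' : IsUnit (q a) :=
      (IsLocalRing.isUnit_or_isUnit_one_sub_self (q a)).resolve_right ha
    exact ⟨b, a, build (by rw [symm, hab]) (isUnit_of_dvd_sub hd ha' (by
      convert hbal using 1; ring)) ha'⟩

variable [Fintype ι] [DecidableEq ι]

/-- If all Gram entries are divisible by `η`, then they are divisible by `η ^ 2` except between
points close to `0` and points close to `1`.  As the number of points is odd, one of these two
groups is smaller, which improves the divisibility of the determinant. -/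
theorem pow_dvd_det_of_dvd (h : NearDegenerate (η ^ 2) q f) (h2 : IsUnit (2 : R))
    (hη : ¬ IsUnit η) (hf : ∀ k l, η ∣ f k l) {m : ℕ} (hι : Fintype.card ι = 2 * m + 1) :
    η ^ (2 * m + 2) ∣ (of f).det := by
  classical
  have hfu : ∀ k l, ¬ IsUnit (f k l) := fun k l hu => hη (isUnit_of_dvd_unit (hf k l) hu)
  have key : ∀ k l, ¬ η ^ 2 ∣ f k l → (¬ IsUnit (q k) ∧ ¬ IsUnit (1 - q l)) ∨
      (¬ IsUnit (1 - q k) ∧ ¬ IsUnit (q l)) := by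
    intro k l hkl
    have h1 : ¬ (IsUnit (q k) ∧ IsUnit (q l)) := fun hu => hkl <|
      (isUnit_add_of_not_isUnit (hfu k l) (h2.mul (hu.1.mul hu.2))).dvd_mul_right.mp (h.left k l)
    have h1' : ¬ (IsUnit (1 - q k) ∧ IsUnit (1 - q l)) := fun hu => hkl <|
      (isUnit_add_of_not_isUnit (hfu k l) (h2.mul (hu.1.mul hu.2))).dvd_mul_right.mp (h.right k l)
    have hk := IsLocalRing.isUnit_or_isUnit_one_sub_self (q k)
    have hl := IsLocalRing.isUnit_or_isUnit_one_sub_self (q l)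
    tauto
  -- weight `1` on a set `P` that meets every large entry, and `η` elsewhere
  have main : ∀ (P : ι → Prop) [DecidablePred P], (Finset.univ.filter P).card ≤ m →
      (∀ k l, ¬ η ^ 2 ∣ f k l → P k ∨ P l) → η ^ (2 * m + 2) ∣ (of f).det := by
    intro P _ hP hPf
    refine dvd_trans ?_ (prod_sq_dvd_det (of f) (fun k => if P k then 1 else η) fun k l => ?_)
    · have hcard := Finset.card_filter_add_card_filter_not (s := (Finset.univ : Finset ι)) P
      rw [Finset.card_univ, hι] at hcard
      rw [Finset.prod_ite, Finset.prod_const, Finset.prod_const, one_pow, one_mul, ← pow_mul]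
      exact pow_dvd_pow _ (by omega)
    · by_cases hk : P k <;> by_cases hl : P l <;> simp only [hk, hl, if_true, if_false, of_apply]
      · simp
      · simpa using hf k l
      · simpa using hf k l
      · rw [← sq]
        by_contra hkl
        exact (hPf k l hkl).elim hk hl
  have hdisj : Disjoint (Finset.univ.filter fun k => ¬ IsUnit (q k))
      (Finset.univ.filter fun k => ¬ IsUnit (1 - q k)) :=
    Finset.disjoint_filter.mpr fun k _ hk hk' =>
      (IsLocalRing.isUnit_or_isUnit_one_sub_self (q k)).elim hk hk'
  have hle := Finset.card_le_univ ((Finset.univ.filter fun k => ¬ IsUnit (q k)) ∪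
      (Finset.univ.filter fun k => ¬ IsUnit (1 - q k)))
  rw [Finset.card_union_of_disjoint hdisj, hι] at hle
  rcases le_or_gt (Finset.univ.filter fun k => ¬ IsUnit (q k)).card m with hu | hu
  · exact main (fun k => ¬ IsUnit (q k)) hu fun k l hkl => by
      have := key k l hkl
      tauto
  · exact main (fun k => ¬ IsUnit (1 - q k)) (by omega) fun k l hkl => by
      have := key k l hkl
      tauto

/-- The Gram determinant of a nearly degenerate configuration of `2 m + 1 ≥ 5` points
(besides the two end points). -/
theorem pow_dvd_det (h : NearDegenerate (η ^ 2) q f) (h2 : IsUnit (2 : R)) (h3 : IsUnit (3 : R))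
    {m : ℕ} (hm : 2 ≤ m) (hι : Fintype.card ι = 2 * m + 1) : η ^ (2 * m + 2) ∣ (of f).det := by
  by_cases hη : IsUnit η
  · exact (hη.pow _).dvd
  by_cases hf : ∀ k l, η ∣ f k l
  · exact h.pow_dvd_det_of_dvd h2 hη hf hι
  have : Nonempty ι := Fintype.card_pos_iff.mp (by omega)
  obtain ⟨a, b, hab⟩ := exists_dvd_all f
  have hs : ¬ η ∣ f a b := fun hd => hf fun k l => hd.trans (hab k l)
  have hs0 : f a b ≠ 0 := fun h0 => hs (h0 ▸ dvd_zero _)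
  obtain ⟨θ, hθ⟩ := (ValuationRing.dvd_total _ _).resolve_left hs
  have hθu : ¬ IsUnit θ := fun hu => hs (by
    obtain ⟨v, rfl⟩ := hu
    exact ⟨↑v⁻¹, by rw [hθ, mul_assoc, Units.mul_inv, mul_one]⟩)
  choose g hg using hab
  have hgab : g a b = 1 := mul_left_cancel₀ hs0 (by rw [mul_one]; exact (hg a b).symm)
  obtain ⟨s, hsf⟩ : ∃ s, s = f a b := ⟨_, rfl⟩
  rw [← hsf] at hs0 hθ
  obtain rfl : f = fun k l => s * g k l := by
    ext k l; rw [hg k l, ← hsf]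
  rw [hθ] at h ⊢
  obtain ⟨a, b, hq⟩ := h.exists_pseudoQuad h2 h3 hs0 hθu hgab
  exact hq.pow_dvd_det hm hι

end NearDegenerate

/-! ### Cayley–Menger matrices -/

section CayleyMenger

open Matrix

variable {R α : Type*} [CommRing R]

/-- The Cayley–Menger matrix of a table `x` of squared distances. -/
def borderedMatrix (x : α → α → R) : Matrix (Option α) (Option α) R
  | none, none => 0
  | none, some _ => 1
  | some _, none => 1
  | some i, some j => x i j

/-- Coordinates adapted to an edge `u v` of length one: `q i` is the position of the orthogonal
projection of the vertex `i` to the line through `u` and `v`, and `f` is the Gram matrix of the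
components orthogonal to that line. -/
structure EdgeCoordinates (y : α → α → R) (u v : α) (q : α → R) (f : α → α → R) : Prop where
  dist : ∀ i j, y i j = (q i - q j) ^ 2 + f i i + f j j - 2 * f i j
  symm : ∀ i j, f i j = f j i
  q_u : q u = 0
  q_v : q v = 1
  f_u : ∀ j, f u j = 0
  f_v : ∀ j, f v j = 0

theorem exists_edgeCoordinates (h2 : IsUnit (2 : R)) {y : α → α → R} (hs : ∀ i j, y i j = y j i)
    (hd : ∀ i, y i i = 0) {u v : α} (huv : y u v = 1) :
    ∃ q f, EdgeCoordinates y u v q f := by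
  obtain ⟨c, hc⟩ := h2.exists_right_inv
  refine ⟨fun i => c * (y u i + 1 - y v i), fun i j => c * (y u i + y u j - y i j) -
    c * (y u i + 1 - y v i) * (c * (y u j + 1 - y v j)), ?_, ?_, ?_, ?_, ?_, ?_⟩
  · intro i j
    simp only [hd]
    linear_combination (-y u i - y u j + (y u i + y u j - y i j)) * hc
  · intro i j
    rw [hs i j]; ring
  · simp [hd, hs v u, huv]
  · simp only [huv, hd]
    linear_combination hc
  · intro j
    simp [hd, hs v u, huv]
  · intro j
    simp only [huv, hd]
    linear_combination (-c * (y u j + 1 - y v j)) * hc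

namespace EdgeCoordinates

variable {y : α → α → R} {u v : α} {q : α → R} {f : α → α → R}

/-- Small areas of triangles make the configuration nearly degenerate. -/
theorem nearDegenerate (h : EdgeCoordinates y u v q f) (h2 : IsUnit (2 : R)) {ε : R}
    (hy : ∀ i j k, ε ∣ heron (y i j) (y j k) (y i k)) : NearDegenerate ε q f := by
  have h4 : IsUnit (4 : R) := by
    have := h2.mul h2; norm_num at this; exact this
  have diag : ∀ k, ε ∣ f k k := by
    intro k
    rw [← h4.dvd_mul_left]
    convert hy u v k using 1
    simp only [heron, h.dist, h.q_u, h.q_v, h.f_u, h.f_v]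
    ring
  have triple : ∀ k l m, ε ∣ 2 * ((q m - q l) * (q k - q m) * f k l +
      (q k - q m) * (q l - q k) * f l m + (q l - q k) * (q m - q l) * f k m) +
        heron (f k l) (f l m) (f k m) := by
    intro k l m
    obtain ⟨x, hx⟩ := diag k
    obtain ⟨z, hz⟩ := diag l
    obtain ⟨w, hw⟩ := diag m
    obtain ⟨t, ht⟩ := hy k l m
    rw [← h4.dvd_mul_left]
    rw [h.dist k l, h.dist l m, h.dist k m, hx, hz, hw, heron] at ht
    rw [heron]
    refine ⟨t - 2 * ((x + z) * ((q l - q m) ^ 2 - 2 * f l m + (q k - q m) ^ 2 - 2 * f k m -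
        ((q k - q l) ^ 2 - 2 * f k l)) +
      (z + w) * ((q k - q l) ^ 2 - 2 * f k l + (q k - q m) ^ 2 - 2 * f k m -
        ((q l - q m) ^ 2 - 2 * f l m)) +
      (x + w) * ((q k - q l) ^ 2 - 2 * f k l + (q l - q m) ^ 2 - 2 * f l m -
        ((q k - q m) ^ 2 - 2 * f k m))) - ε * heron (x + z) (z + w) (x + w), ?_⟩
    rw [heron]
    linear_combination ht
  refine ⟨h.symm, diag, fun k l => ?_, fun k l => ?_, triple⟩
  · have := triple u k l
    rw [← dvd_neg]
    convert this using 1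
    simp only [heron, h.q_u, h.f_u]
    ring
  · have := triple v k l
    rw [← dvd_neg]
    convert this using 1
    simp only [heron, h.q_v, h.f_v]
    ring

end EdgeCoordinates

variable [Fintype α] [DecidableEq α]

theorem map_det_borderedMatrix {S : Type*} [CommRing S] (φ : R →+* S) (x : α → α → R) :
    φ (borderedMatrix x).det = (borderedMatrix fun i j => φ (x i j)).det := by
  rw [RingHom.map_det]
  congr 1
  ext i j
  rcases i with _ | i <;> rcases j with _ | j <;> simp [borderedMatrix]

theorem det_borderedMatrix_equiv {β : Type*} [Fintype β] [DecidableEq β] (e : β ≃ α)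
    (x : α → α → R) :
    (borderedMatrix x).det = (borderedMatrix fun i j => x (e i) (e j)).det := by
  rw [← det_submatrix_equiv_self (Equiv.optionCongr e)]
  congr 1
  ext i j
  rcases i with _ | i <;> rcases j with _ | j <;> simp [borderedMatrix]

/-- The Cayley–Menger determinant of `N` points is homogeneous of degree `N - 1`. -/
theorem mul_det_borderedMatrix_mul (c : R) (y : α → α → R) :
    c * (borderedMatrix fun i j => c * y i j).det =
      c ^ Fintype.card α * (borderedMatrix y).det := by
  have h1 := det_mul_row (fun j : Option α => j.elim c fun _ => 1)
    (borderedMatrix fun i j => c * y i j)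
  have h2 := det_mul_column (fun j : Option α => j.elim 1 fun _ => c) (borderedMatrix y)
  simp only [Fintype.prod_option, Option.elim_none, Option.elim_some, Finset.prod_const_one,
    mul_one, one_mul, Finset.prod_const, Finset.card_univ] at h1 h2
  rw [← h1, ← h2]
  congr 1
  ext i j
  rcases i with _ | i <;> rcases j with _ | j <;> simp [borderedMatrix]

/-- Subtracting multiples of three pivot rows does not change the determinant. -/
theorem det_sub_three_rows {ι : Type*} [Fintype ι] [DecidableEq ι] (M : Matrix ι ι R)
    (p₁ p₂ p₃ : ι) (c₁ c₂ c₃ : ι → R) (h₁ : c₁ p₁ = 0) (h₂ : c₂ p₂ = 0) (h₃ : c₃ p₃ = 0)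
    (h₂₁ : c₁ p₂ = 0) (h₃₁ : c₁ p₃ = 0) (h₃₂ : c₂ p₃ = 0) :
    (of fun i j => M i j - c₁ i * M p₁ j - c₂ i * M p₂ j - c₃ i * M p₃ j).det = M.det := by
  have e₁ : (of fun i j => M i j - c₁ i * M p₁ j).det = M.det :=
    det_eq_of_forall_row_eq_smul_add_const (fun k => -c₁ k) p₁ (by simp [h₁])
      fun k l => by simp only [of_apply]; ring
  have e₂ : (of fun i j => M i j - c₁ i * M p₁ j - c₂ i * M p₂ j).det = M.det := by
    rw [← e₁]
    exact det_eq_of_forall_row_eq_smul_add_const (fun k => -c₂ k) p₂ (by simp [h₂])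
      fun k l => by simp only [of_apply, h₂₁]; ring
  rw [← e₂]
  exact det_eq_of_forall_row_eq_smul_add_const (fun k => -c₃ k) p₃ (by simp [h₃])
    fun k l => by simp only [of_apply, h₃₁, h₃₂]; ring

namespace EdgeCoordinates

variable {y : α → α → R} {u v : α} {q : α → R} {f : α → α → R}

/-- Row operations reduce the Cayley–Menger determinant to the Gram determinant of the components
orthogonal to the edge.  The remaining rows are those outside `p`; they belong to vertices, so that
the default value `u` in `getD` plays no role. -/
theorem det_borderedMatrix (h : EdgeCoordinates y u v q f) (p : Option α → Prop) [DecidablePred p]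
    (hp : ∀ a, p a ↔ a = none ∨ a = some u ∨ a = some v) :
    (borderedMatrix y).det = (toSquareBlockProp (borderedMatrix y) p).det *
      ((-2) ^ Fintype.card {a // ¬ p a} *
        (of fun a b : {a // ¬ p a} => f (a.1.getD u) (b.1.getD u)).det) := by
  have f_u' : ∀ j, f j u = 0 := fun j => by rw [h.symm, h.f_u]
  have f_v' : ∀ j, f j v = 0 := fun j => by rw [h.symm, h.f_v]
  have hp0 : p none := by simp [hp]
  have hpu : p (some u) := by simp [hp]
  have hpv : p (some v) := by simp [hp]
  -- row `i` minus the affine combination `(1 - q i) u + q i v` and a multiple of the border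
  -- vanishes in the columns of the border, `u` and `v`
  rw [← det_sub_three_rows (borderedMatrix y) none (some u) (some v)
    (fun a => if p a then 0 else f (a.getD u) (a.getD u) + q (a.getD u) ^ 2 - q (a.getD u))
    (fun a => if p a then 0 else 1 - q (a.getD u))
    (fun a => if p a then 0 else q (a.getD u)) (by simp [hp0]) (by simp [hpu]) (by simp [hpv])
    (by simp [hpu]) (by simp [hpv]) (by simp [hpv]), twoBlockTriangular_det _ p]
  · congr 1
    · congr 1
      ext a b
      simp [toSquareBlockProp, a.2]
    · rw [← det_smul]
      congr 1
      ext ⟨a, ha⟩ ⟨b, hb⟩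
      rcases a with _ | i
      · exact absurd hp0 ha
      rcases b with _ | j
      · exact absurd hp0 hb
      simp only [toSquareBlockProp, toBlock_apply, of_apply, if_neg ha, borderedMatrix,
        Option.getD_some, Matrix.smul_apply, smul_eq_mul, h.dist, h.q_u, h.q_v, h.f_u, h.f_v]
      ring
  · intro a ha b hb
    rcases a with _ | i
    · exact absurd hp0 ha
    rcases (hp b).mp hb with rfl | rfl | rfl <;>
    · simp only [of_apply, if_neg ha, borderedMatrix, Option.getD_some, h.dist, h.q_u, h.q_v,
        h.f_u, h.f_v, f_u', f_v']
      ring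

end EdgeCoordinates

/-- For an odd number `2 m + 3 ≥ 7` of points over a valuation ring, one of whose squared
distances is `1`, and all of whose squared areas are divisible by `η ^ 2`, the Cayley–Menger
determinant is divisible by `η ^ (2 m + 2)`. -/
theorem pow_dvd_det_borderedMatrix [IsDomain R] [ValuationRing R] (h2 : IsUnit (2 : R))
    (h3 : IsUnit (3 : R)) {y : α → α → R} (hs : ∀ i j, y i j = y j i) (hd : ∀ i, y i i = 0)
    {u v : α} (huv : y u v = 1) {η : R}
    (hy : ∀ i j k, η ^ 2 ∣ heron (y i j) (y j k) (y i k)) {m : ℕ} (hm : 2 ≤ m)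
    (hα : Fintype.card α = 2 * m + 3) : η ^ (2 * m + 2) ∣ (borderedMatrix y).det := by
  obtain ⟨q, f, h⟩ := exists_edgeCoordinates h2 hs hd huv
  have hne : u ≠ v := by
    rintro rfl
    exact one_ne_zero (huv.symm.trans (hd u))
  let p : Option α → Prop := fun a => a = none ∨ a = some u ∨ a = some v
  rw [h.det_borderedMatrix p fun _ => Iff.rfl]
  have hN := h.nearDegenerate h2 hy
  have hN' : NearDegenerate (η ^ 2) (fun a : {a // ¬ p a} => q (a.1.getD u))
      (fun a b : {a // ¬ p a} => f (a.1.getD u) (b.1.getD u)) :=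
    ⟨fun _ _ => hN.symm _ _, fun _ => hN.diag _, fun _ _ => hN.left _ _,
      fun _ _ => hN.right _ _, fun _ _ _ => hN.triple _ _ _⟩
  refine ((hN'.pow_dvd_det h2 h3 hm ?_).mul_left _).mul_left _
  have hp : Fintype.card {a // p a} = 3 := by
    rw [Fintype.card_subtype]
    have : (Finset.univ.filter p) = {none, some u, some v} := by
      ext a; simp [p]
    rw [this, Finset.card_insert_of_notMem (by simp), Finset.card_pair (by simpa using hne)]
  rw [Fintype.card_subtype_compl, hp, Fintype.card_option, hα]
  omega

end CayleyMenger

/-! ### Bounded areas and bounded volume -/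

/-- For an odd number of at least seven points, a valuation ring that contains all areas contains
the Cayley–Menger determinant. -/
theorem det_borderedMatrix_mem {K α : Type*} [Field K] [Fintype α] [DecidableEq α]
    (A : ValuationSubring K) (h2 : IsUnit (2 : A)) (h3 : IsUnit (3 : A)) {x : α → α → K}
    (hs : ∀ i j, x i j = x j i) (hd : ∀ i, x i i = 0)
    (hx : ∀ i j k, heron (x i j) (x j k) (x i k) ∈ A) {m : ℕ} (hm : 2 ≤ m)
    (hα : Fintype.card α = 2 * m + 3) : (borderedMatrix x).det ∈ A := by
  have : Nonempty α := Fintype.card_pos_iff.mp (by omega)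
  obtain ⟨⟨u, v⟩, huv⟩ := Finite.exists_max fun p : α × α => A.valuation (x p.1 p.2)
  by_cases hmem : x u v ∈ A
  · have hall : ∀ i j, x i j ∈ A := fun i j => by
      rw [← A.valuation_le_one_iff] at hmem ⊢
      exact (huv (i, j)).trans hmem
    have := map_det_borderedMatrix A.subtype fun i j => ⟨x i j, hall i j⟩
    rw [show (borderedMatrix x) = borderedMatrix fun i j => A.subtype ⟨x i j, hall i j⟩ from rfl,
      ← this]
    exact Subtype.property _
  · -- rescale by the largest squared length
    have h0 : x u v ≠ 0 := fun h => hmem (h ▸ A.zero_mem)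
    have hη : (x u v)⁻¹ ∈ A := (A.mem_or_inv_mem _).resolve_left hmem
    have hy : ∀ i j, (x u v)⁻¹ * x i j ∈ A := fun i j => by
      rw [← A.valuation_le_one_iff, map_mul, map_inv₀]
      have hpos : 0 < A.valuation (x u v) := by
        rw [zero_lt_iff]; exact (A.valuation.ne_zero_iff).mpr h0
      rw [inv_mul_le_one₀ hpos]
      exact huv (i, j)
    let η : A := ⟨_, hη⟩
    let y : α → α → A := fun i j => ⟨_, hy i j⟩
    have hdvd : η ^ (2 * m + 2) ∣ (borderedMatrix y).det := by
      refine pow_dvd_det_borderedMatrix h2 h3 (u := u) (v := v) (fun i j => ?_) (fun i => ?_) ?_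
        (fun i j k => ⟨⟨_, hx i j k⟩, ?_⟩) hm hα
      · exact Subtype.ext (by simp only [y, hs i j])
      · exact Subtype.ext (by simp [y, hd])
      · exact Subtype.ext (by simp [y, h0])
      · apply A.subtype_injective
        simp only [y, η, heron, map_sub, map_mul, map_add, map_pow, map_ofNat,
          ValuationSubring.subtype_apply]
        ring
    obtain ⟨r, hr⟩ := hdvd
    have h1 := map_det_borderedMatrix A.subtype y
    have h2 := mul_det_borderedMatrix_mul (x u v) fun i j => A.subtype (y i j)
    rw [← h1, hr, hα] at h2
    have hxy : (fun i j => x u v * A.subtype (y i j)) = x := by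
      ext i j
      simp [y, h0]
    rw [hxy] at h2
    have : (borderedMatrix x).det = A.subtype r := by
      refine mul_left_cancel₀ h0 (h2.trans ?_)
      simp only [map_mul, map_pow, η, ValuationSubring.subtype_apply]
      rw [pow_succ, inv_pow]
      field_simp
    rw [this]
    exact r.2

/-! ### Volumes of faces -/

section Faces

variable {n : ℕ}

theorem len_comm (i j : Fin (n + 1)) : len i j = len j i := by
  unfold len
  by_cases h : i = j
  · simp [h]
  · rw [dif_neg h, dif_neg (Ne.symm h)]
    congr 2
    exact Sym2.eq_swap

theorem len_self (i : Fin (n + 1)) : len i i = 0 := dif_pos rfl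

theorem cayleyMengerMatrix_eq {k : ℕ} (F : Face n k) :
    cayleyMengerMatrix F = borderedMatrix fun i j => len i.1 j.1 ^ 2 := by
  ext i j
  rcases i with _ | i <;> rcases j with _ | j <;> rfl

theorem det_borderedMatrix_fin_three {R : Type*} [CommRing R] {x : Fin 3 → Fin 3 → R}
    (hs : ∀ i j, x i j = x j i) (hd : ∀ i, x i i = 0) :
    (borderedMatrix x).det = -heron (x 0 1) (x 1 2) (x 0 2) := by
  rw [← Matrix.det_submatrix_equiv_self (finSuccEquiv 3)]
  have e0 : finSuccEquiv 3 0 = none := rfl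
  have e1 : finSuccEquiv 3 1 = some 0 := rfl
  have e2 : finSuccEquiv 3 2 = some 1 := rfl
  have e3 : finSuccEquiv 3 3 = some 2 := rfl
  simp [-Matrix.det_submatrix_equiv_self, Matrix.det_succ_row_zero, Fin.sum_univ_succ,
    Fin.succAbove, borderedMatrix, e0, e1, e2, e3,
    hd, hs 1 0, hs 2 0, hs 2 1, heron]
  ring

theorem heron_eq_volumeSq (F : Face n 2) (e : Fin 3 ≃ F.1) :
    heron (len (e 0).1 (e 1).1 ^ 2) (len (e 1).1 (e 2).1 ^ 2) (len (e 0).1 (e 2).1 ^ 2) =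
      16 * volumeSq F := by
  rw [volumeSq, cayleyMengerMatrix_eq, det_borderedMatrix_equiv e, det_borderedMatrix_fin_three
    (fun i j => by rw [len_comm]) (fun i => by rw [len_self]; ring)]
  have : (16 : LengthRing n) = MvPolynomial.C 16 := (map_ofNat MvPolynomial.C 16).symm
  rw [this, ← mul_assoc, ← MvPolynomial.C_mul]
  norm_num [Nat.factorial]

/-- `heron` of the squared edge lengths vanishes when two of the three vertices coincide, and is
`16` times a squared area otherwise. -/
theorem heron_len (i j k : Fin (n + 1)) :
    heron (len i j ^ 2) (len j k ^ 2) (len i k ^ 2) = 0 ∨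
      ∃ F : Face n 2, heron (len i j ^ 2) (len j k ^ 2) (len i k ^ 2) = 16 * volumeSq F := by
  by_cases hij : i = j
  · subst hij; left; rw [len_self, heron]; ring
  by_cases hjk : j = k
  · subst hjk; left; rw [len_self, heron]; ring
  by_cases hik : i = k
  · subst hik; left; rw [len_self, len_comm j i, heron]; ring
  right
  let F : Face n 2 := ⟨{i, j, k}, Finset.card_eq_three.mpr ⟨i, j, k, hij, hik, hjk, rfl⟩⟩
  let v : Fin 3 → F.1 := ![⟨i, by simp [F]⟩, ⟨j, by simp [F]⟩, ⟨k, by simp [F]⟩]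
  have hv : Function.Bijective v := by
    rw [Fintype.bijective_iff_surjective_and_card]
    refine ⟨?_, by simp [F.2]⟩
    rintro ⟨x, hx⟩
    have hx' : x = i ∨ x = j ∨ x = k := by simpa [F] using hx
    rcases hx' with rfl | rfl | rfl
    · exact ⟨0, rfl⟩
    · exact ⟨1, rfl⟩
    · exact ⟨2, rfl⟩
  exact ⟨F, heron_eq_volumeSq F (Equiv.ofBijective v hv)⟩

theorem volumeSq_univ (n : ℕ) : ∃ c : ℚ, c ≠ 0 ∧ volumeSq (⟨Finset.univ, by simp⟩ : Face n n) =
    MvPolynomial.C c * (borderedMatrix fun i j : Fin (n + 1) => len i j ^ 2).det := by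
  refine ⟨(-1) ^ (n + 1) / (2 ^ n * (n.factorial : ℚ) ^ 2), by positivity, ?_⟩
  rw [volumeSq, cayleyMengerMatrix_eq]
  congr 1
  rw [det_borderedMatrix_equiv (Equiv.subtypeUnivEquiv (p := fun i : Fin (n + 1) =>
    i ∈ Finset.univ) Finset.mem_univ)]
  rfl

end Faces

/-! ### Integrality -/

/-- An element of a field lies in the integral closure of a subalgebra as soon as it lies in all
valuation subrings that contain the subalgebra. -/
theorem isIntegral_of_forall_valuationSubring {k K : Type*} [Field k] [Field K] [Algebra k K]
    (S : Subalgebra k K) {x : K} (h : ∀ A : ValuationSubring K, (S : Set K) ⊆ A → x ∈ A) :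
    IsIntegral S x := by
  have hx : x ∈ (integralClosure (Subring.closure (S : Set K)) K).toSubring := by
    rw [← iInf_valuationSubring_superset, Subring.mem_iInf]
    exact fun V => h V.1 V.2
  have hx' : IsIntegral (Subring.closure (S : Set K)) x := hx
  have hle : Subring.closure (S : Set K) ≤ S.toSubring := Subring.closure_le.mpr fun _ h => h
  exact hx'.map_of_comp_eq (Subring.inclusion hle) (RingHom.id K) rfl

/-- For even `n ≥ 6`, a valuation ring that contains all areas contains the volume. -/
theorem simplexVolume_mem {n m : ℕ} (hm : 2 ≤ m) (hn : n = 2 * m + 2)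
    (A : ValuationSubring (LengthField n))
    (hA : (faceAlgebra n 2 : Set (LengthField n)) ⊆ A) : simplexVolume n ∈ A := by
  have hq : ∀ c : ℚ, algebraMap ℚ (LengthField n) c ∈ A :=
    fun c => hA (Subalgebra.algebraMap_mem _ c)
  have hunit : ∀ k : ℕ, k ≠ 0 → IsUnit (k : A) := fun k hk => by
    refine IsUnit.of_mul_eq_one ⟨_, hq (k : ℚ)⁻¹⟩ (A.subtype_injective ?_)
    have : (k : LengthField n) ≠ 0 := Nat.cast_ne_zero.mpr hk
    simp [this]
  let ι := algebraMap (LengthRing n) (LengthField n)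
  have hF : ∀ F : Face n 2, ι (volumeSq F) ∈ A := fun F => by
    rw [← volume_sq]
    exact A.toSubring.pow_mem (hA (Algebra.subset_adjoin ⟨F, rfl⟩)) 2
  have hdet : (borderedMatrix fun i j : Fin (n + 1) => ι (len i j ^ 2)).det ∈ A := by
    refine det_borderedMatrix_mem A (hunit 2 two_ne_zero) (hunit 3 three_ne_zero)
      (fun i j => by rw [len_comm]) (fun i => by simp [len_self]) (fun i j k => ?_) hm
      (by simp [hn])
    have : heron (ι (len i j ^ 2)) (ι (len j k ^ 2)) (ι (len i k ^ 2)) =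
        ι (heron (len i j ^ 2) (len j k ^ 2) (len i k ^ 2)) := by
      simp only [heron, map_sub, map_mul, map_add, map_pow, map_ofNat]
    rw [this]
    rcases heron_len i j k with h | ⟨F, h⟩
    · rw [h, map_zero]; exact A.zero_mem
    · rw [h, map_mul, map_ofNat]
      exact A.mul_mem _ _ (by simp) (hF F)
  obtain ⟨c, -, hc⟩ := volumeSq_univ n
  have hsq : simplexVolume n ^ 2 ∈ A := by
    rw [simplexVolume, volume_sq, hc, map_mul, map_det_borderedMatrix]
    refine A.mul_mem _ _ ?_ hdet
    have := hq c
    rwa [IsScalarTower.algebraMap_apply ℚ (LengthRing n)] at this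
  rcases A.mem_or_inv_mem (simplexVolume n) with h | h
  · exact h
  · by_cases h0 : simplexVolume n = 0
    · rw [h0]; exact A.zero_mem
    · have := A.mul_mem _ _ hsq h
      rwa [sq, mul_assoc, mul_inv_cancel₀ h0, mul_one] at this

theorem isIntegral_simplexVolume {n : ℕ} (hn : Even n) (h6 : 6 ≤ n) :
    IsIntegral (faceAlgebra n 2) (simplexVolume n) := by
  obtain ⟨r, hr⟩ := hn
  exact isIntegral_of_forall_valuationSubring _ fun A hA =>
    simplexVolume_mem (m := r - 1) (by omega) (by omega) A hA

/-- Let `V` be integral over the algebra generated by a set `T`.  If the squares of `V` and of the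
elements of `T` lie in a subring `R`, then `V ^ 2` is integral over any subalgebra of `R` that
contains the squares of the elements of `T`. -/
theorem isIntegral_of_isIntegral_adjoin {k R L : Type*} [Field k] [CommRing R] [Field L]
    [Algebra k R] [Algebra k L] [Algebra R L] [IsScalarTower k R L]
    (hinj : Function.Injective (algebraMap R L)) (D : Subalgebra k R) {T : Set L}
    (hT : ∀ t ∈ T, ∃ r ∈ D, t ^ 2 = algebraMap R L r) {V : L} {r : R}
    (hV : V ^ 2 = algebraMap R L r) (hint : IsIntegral (Algebra.adjoin k T) V) :
    IsIntegral D r := by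
  have hle : Algebra.adjoin k T ≤ (integralClosure D L).restrictScalars k := by
    refine Algebra.adjoin_le fun t ht => ?_
    obtain ⟨r, hr, h⟩ := hT t ht
    refine IsIntegral.of_pow two_pos ?_
    rw [h]
    exact isIntegral_algebraMap (R := D) (x := ⟨r, hr⟩)
  have h1 : IsIntegral (integralClosure D L) V :=
    hint.map_of_comp_eq (Subring.inclusion (S := (Algebra.adjoin k T).toSubring)
      (T := (integralClosure D L).toSubring) hle) (RingHom.id _) rfl
  have h2 : IsIntegral D (V ^ 2) := (isIntegral_trans _ h1).pow 2
  rw [hV] at h2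
  exact (isIntegral_algebraMap_iff hinj).mp h2

theorem algebraMap_lengthField_injective (n : ℕ) :
    Function.Injective (algebraMap (LengthRing n) (LengthField n)) := by
  rw [IsScalarTower.algebraMap_eq (LengthRing n) (FractionRing (LengthRing n)) (LengthField n)]
  exact (algebraMap (FractionRing (LengthRing n)) (LengthField n)).injective.comp
    (IsFractionRing.injective _ _)

/-- Any symmetric table with zero diagonal is a specialization of the edge lengths. -/
theorem exists_specialization {K : Type*} [Field K] [Algebra ℚ K] {n : ℕ}
    {x : Fin (n + 1) → Fin (n + 1) → K} (hs : ∀ i j, x i j = x j i) (hd : ∀ i, x i i = 0) :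
    ∃ φ : LengthRing n →ₐ[ℚ] K, ∀ i j, φ (len i j) = x i j := by
  refine ⟨MvPolynomial.aeval fun e => Sym2.lift ⟨x, hs⟩ e.1, fun i j => ?_⟩
  unfold len
  split_ifs with h
  · simp [h, hd]
  · simp

open Polynomial in
/-- A specialization of the edge lengths to rational functions in one variable, with polynomial
squared areas and a non-polynomial squared volume, is an obstruction to integrality. -/
theorem not_isIntegral_simplexVolume {n : ℕ} {α : Type*} [Fintype α] [DecidableEq α]
    (e : Fin (n + 1) ≃ α) {x : α → α → RatFunc ℚ} (hs : ∀ i j, x i j = x j i)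
    (hd : ∀ i, x i i = 0)
    (harea : ∀ i j k, heron (x i j ^ 2) (x j k ^ 2) (x i k ^ 2) ∈
      (algebraMap ℚ[X] (RatFunc ℚ)).range)
    (hvol : (borderedMatrix fun i j => x i j ^ 2).det ∉ (algebraMap ℚ[X] (RatFunc ℚ)).range) :
    ¬ IsIntegral (faceAlgebra n 2) (simplexVolume n) := by
  intro hint
  obtain ⟨φ, hφ⟩ := exists_specialization (x := fun i j => x (e i) (e j))
    (fun i j => hs _ _) (fun i => hd _)
  -- the polynomials in the edge lengths whose specialization is a polynomial in `X`
  let D : Subalgebra ℚ (LengthRing n) :=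
    (IsScalarTower.toAlgHom ℚ ℚ[X] (RatFunc ℚ)).range.comap φ
  have hD : ∀ p, p ∈ D ↔ φ p ∈ (algebraMap ℚ[X] (RatFunc ℚ)).range := fun p => Iff.rfl
  have hF : ∀ F : Face n 2, volumeSq F ∈ D := by
    intro F
    have h := heron_eq_volumeSq F (F.1.equivFinOfCardEq F.2).symm
    set v := (F.1.equivFinOfCardEq F.2).symm
    have h' : volumeSq F = MvPolynomial.C (1 / 16) * heron (len (v 0).1 (v 1).1 ^ 2)
        (len (v 1).1 (v 2).1 ^ 2) (len (v 0).1 (v 2).1 ^ 2) := by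
      have : (16 : LengthRing n) = MvPolynomial.C 16 := (map_ofNat MvPolynomial.C 16).symm
      rw [h, this, ← mul_assoc, ← MvPolynomial.C_mul]
      norm_num
    rw [h']
    refine D.mul_mem (D.algebraMap_mem _) ((hD _).mpr ?_)
    have := harea (e (v 0).1) (e (v 1).1) (e (v 2).1)
    simpa only [heron, map_sub, map_mul, map_add, map_pow, map_ofNat, hφ] using this
  have h3 : IsIntegral D (volumeSq (⟨Finset.univ, by simp⟩ : Face n n)) := by
    refine isIntegral_of_isIntegral_adjoin (algebraMap_lengthField_injective n) D ?_
      (volume_sq _) hint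
    rintro _ ⟨F, rfl⟩
    exact ⟨volumeSq F, hF F, volume_sq F⟩
  have h4 : IsIntegral ℚ[X] (φ (volumeSq (⟨Finset.univ, by simp⟩ : Face n n))) := by
    have h5 : IsIntegral (algebraMap ℚ[X] (RatFunc ℚ)).range
        (φ (volumeSq (⟨Finset.univ, by simp⟩ : Face n n))) :=
      h3.map_of_comp_eq ((φ.toRingHom.comp D.val.toRingHom).codRestrict
        (algebraMap ℚ[X] (RatFunc ℚ)).range fun p => p.2) φ.toRingHom rfl
    obtain ⟨p, hp, hp0⟩ := h5
    obtain ⟨p', rfl, -, hp'⟩ := Polynomial.lifts_and_natDegree_eq_and_monic (f :=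
      (algebraMap ℚ[X] (RatFunc ℚ)).rangeRestrict) (p := p) (by
        rw [Polynomial.mem_lifts]
        exact Polynomial.map_surjective _ (RingHom.rangeRestrict_surjective _) p) hp
    refine ⟨p', hp', ?_⟩
    rw [Polynomial.eval₂_map] at hp0
    exact hp0
  obtain ⟨y, hy⟩ := IsIntegrallyClosed.isIntegral_iff.mp h4
  obtain ⟨c, hc0, hc⟩ := volumeSq_univ n
  refine hvol ⟨Polynomial.C c⁻¹ * y, ?_⟩
  have hdet : φ (borderedMatrix fun i j : Fin (n + 1) => len i j ^ 2).det =
      (borderedMatrix fun i j => x i j ^ 2).det := by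
    rw [det_borderedMatrix_equiv e]
    have := map_det_borderedMatrix φ.toRingHom fun i j : Fin (n + 1) => len i j ^ 2
    simpa only [AlgHom.toRingHom_eq_coe, RingHom.coe_coe, map_pow, hφ] using this
  have hC : ∀ c : ℚ, φ (MvPolynomial.C c) = algebraMap ℚ[X] (RatFunc ℚ) (C c) := fun c => by
    rw [← MvPolynomial.algebraMap_eq, AlgHom.commutes, ← Polynomial.algebraMap_eq,
      ← IsScalarTower.algebraMap_apply]
  rw [hc, map_mul, hdet, hC] at hy
  rw [map_mul, hy, ← mul_assoc, ← map_mul, ← C_mul, inv_mul_cancel₀ hc0, C_1, map_one, one_mul]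

/-! ### Obstructions to integrality -/

section Obstructions

open Matrix Polynomial

/-- Squared distances of two groups of `c` points each: distances within a group vanish, and the
squared distance of the `i`-th point of one group and the `j`-th point of the other is
`a + b δ_ij`. -/
def twoGroups {K : Type*} [Field K] (c : ℕ) (a b : K) : Fin c ⊕ Fin c → Fin c ⊕ Fin c → K
  | .inl _, .inl _ => 0
  | .inr _, .inr _ => 0
  | .inl i, .inr j => a + b * if i = j then 1 else 0
  | .inr j, .inl i => a + b * if i = j then 1 else 0

/-- The Cayley–Menger determinant of two groups of points, up to sign. -/
theorem det_twoGroups {K : Type*} [Field K] (c : ℕ) (a : K) {b : K} (hb : b ≠ 0) (hc : 1 ≤ c) :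
    (borderedMatrix (twoGroups c a b)).det = 2 * c * b ^ (2 * c - 2) * (c * a + b) ∨
      (borderedMatrix (twoGroups c a b)).det = -(2 * c * b ^ (2 * c - 2) * (c * a + b)) := by
  -- subtracting multiples of the border removes `a` from the entries between the two
  -- groups; the matrix without its border is then `M`, with inverse `N`
  let M : Matrix (Fin c ⊕ Fin c) (Fin c ⊕ Fin c) K :=
    fromBlocks 0 (b • 1) (b • 1) (of fun _ _ => -2 * a)
  let N : Matrix (Fin c ⊕ Fin c) (Fin c ⊕ Fin c) K :=
    fromBlocks (of fun _ _ => 2 * a / b ^ 2) (b⁻¹ • 1) (b⁻¹ • 1) 0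
  have hMN : M * N = 1 := by
    simp only [M, N, fromBlocks_multiply, ← fromBlocks_one]
    congr 1
    · simp [smul_smul, hb]
    · simp
    · ext i j
      simp
      field_simp
      ring
    · simp [smul_smul, hb]
  let _ : Invertible M := invertibleOfRightInverse M N hMN
  have hN : ⅟M = N := rfl
  have hdetM : M.det = b ^ (2 * c) ∨ M.det = -b ^ (2 * c) := by
    have h1 := det_permute' (Equiv.sumComm (Fin c) (Fin c)) M
    have h2 : (M.submatrix id (Equiv.sumComm (Fin c) (Fin c))) =
        fromBlocks (b • 1) 0 (of fun _ _ => -2 * a) (b • 1) := by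
      ext i j
      rcases i with i | i <;> rcases j with j | j <;> rfl
    rw [h2, det_fromBlocks_zero₁₂, det_smul, det_one, mul_one, Fintype.card_fin, ← pow_add,
      ← two_mul] at h1
    rcases Int.units_eq_one_or (Equiv.Perm.sign (Equiv.sumComm (Fin c) (Fin c))) with h | h
    · left; rw [h1, h]; simp
    · right; rw [h1, h]; simp
  have hdet : (borderedMatrix (twoGroups c a b)).det =
      M.det * -(2 * c * (c * a + b) / b ^ 2) := by
    rw [← det_sub_pivot _ none (fun k => k.elim 0 (Sum.elim (fun _ => 0) fun _ => a)) rfl]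
    rw [← det_submatrix_equiv_self (Equiv.optionEquivSumPUnit.{0} (Fin c ⊕ Fin c)).symm]
    have : ((of fun k l => borderedMatrix (twoGroups c a b) k l -
        (k.elim 0 (Sum.elim (fun _ => 0) fun _ => a)) * borderedMatrix (twoGroups c a b) none l -
        (l.elim 0 (Sum.elim (fun _ => 0) fun _ => a)) * borderedMatrix (twoGroups c a b) k none +
        (k.elim 0 (Sum.elim (fun _ => 0) fun _ => a)) *
          (l.elim 0 (Sum.elim (fun _ => 0) fun _ => a)) *
          borderedMatrix (twoGroups c a b) none none).submatrix
        (Equiv.optionEquivSumPUnit.{0} (Fin c ⊕ Fin c)).symm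
        (Equiv.optionEquivSumPUnit.{0} (Fin c ⊕ Fin c)).symm) =
        fromBlocks M (of fun _ _ => 1) (of fun _ _ => 1) 0 := by
      ext i j
      rcases i with (i | i) | i <;> rcases j with (j | j) | j <;>
        simp [borderedMatrix, twoGroups, M, Matrix.one_apply, eq_comm]
      ring
    rw [this, det_fromBlocks₁₁, hN]
    congr 1
    rw [det_unique]
    simp [N, Matrix.mul_apply, Fintype.sum_sum_type, Matrix.one_apply, Finset.sum_add_distrib]
    field_simp
    ring
  obtain ⟨d, rfl⟩ : ∃ d, c = d + 1 := ⟨c - 1, by omega⟩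
  have e : b ^ (2 * (d + 1)) = b ^ (2 * (d + 1) - 2) * b ^ 2 := by
    rw [← pow_add]; congr 1
  rw [hdet]
  rcases hdetM with h | h <;> rw [h, e]
  · right; field_simp
  · left; field_simp

theorem heron_twoGroups {K : Type*} [Field K] (c : ℕ) (a b : K) (i j k : Fin c ⊕ Fin c) :
    heron (twoGroups c a b i j) (twoGroups c a b j k) (twoGroups c a b i k) = 0 ∨
      heron (twoGroups c a b i j) (twoGroups c a b j k) (twoGroups c a b i k) = -b ^ 2 := by
  rcases i with i | i <;> rcases j with j | j <;> rcases k with k | k <;>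
    simp only [twoGroups, heron] <;> (try split_ifs) <;>
    first | (left; ring1) | (right; ring1)

/-- For an even number `2 c` of vertices, the two groups with edge lengths `1/X + X δ_ij` between
them have bounded areas, but the volume has a pole at `X = 0`. -/
theorem not_isIntegral_of_odd {n : ℕ} (hn : Odd n) :
    ¬ IsIntegral (faceAlgebra n 2) (simplexVolume n) := by
  obtain ⟨d, hd⟩ := hn
  obtain ⟨c, hc, hnc⟩ : ∃ c, 1 ≤ c ∧ n + 1 = c + c := ⟨d + 1, by omega, by omega⟩
  have hX : (RatFunc.X : RatFunc ℚ) ≠ 0 := RatFunc.X_ne_zero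
  have hT : (fun i j => twoGroups c (RatFunc.X : RatFunc ℚ)⁻¹ RatFunc.X i j ^ 2) =
      twoGroups c ((RatFunc.X : RatFunc ℚ)⁻¹ ^ 2) (2 + RatFunc.X ^ 2) := by
    ext i j
    rcases i with i | i <;> rcases j with j | j <;> simp only [twoGroups]
    · simp
    · split_ifs <;> field_simp <;> ring
    · split_ifs <;> field_simp <;> ring
    · simp
  have hb : (2 + RatFunc.X ^ 2 : RatFunc ℚ) = algebraMap ℚ[X] (RatFunc ℚ) (2 + X ^ 2) := by
    simp only [map_add, map_pow, map_ofNat, RatFunc.algebraMap_X]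
  have hb0 : (2 + RatFunc.X ^ 2 : RatFunc ℚ) ≠ 0 := by
    rw [hb]
    intro h
    have h' := (map_eq_zero_iff _ (IsFractionRing.injective ℚ[X] (RatFunc ℚ))).mp h
    have h'' := congrArg (Polynomial.eval 0) h'
    simp at h''
  refine not_isIntegral_simplexVolume ((finCongr hnc).trans finSumFinEquiv.symm)
    (x := twoGroups c (RatFunc.X : RatFunc ℚ)⁻¹ RatFunc.X) ?_ ?_ ?_ ?_
  · intro i j
    rcases i with i | i <;> rcases j with j | j <;> rfl
  · intro i
    rcases i with i | i <;> rfl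
  · intro i j k
    have hT' : ∀ i j, twoGroups c (RatFunc.X : RatFunc ℚ)⁻¹ RatFunc.X i j ^ 2 =
        twoGroups c ((RatFunc.X : RatFunc ℚ)⁻¹ ^ 2) (2 + RatFunc.X ^ 2) i j :=
      fun i j => congrFun (congrFun hT i) j
    rw [hT', hT', hT']
    rcases heron_twoGroups c ((RatFunc.X : RatFunc ℚ)⁻¹ ^ 2) (2 + RatFunc.X ^ 2) i j k with h | h
    · rw [h]; exact zero_mem _
    · rw [h, hb]; exact ⟨-(2 + X ^ 2) ^ 2, by simp only [map_neg, map_pow]⟩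
  · rintro ⟨p, hp⟩
    rw [hT] at hp
    have key : ∀ p : ℚ[X], algebraMap ℚ[X] (RatFunc ℚ) p =
        2 * (c : RatFunc ℚ) * (2 + RatFunc.X ^ 2) ^ (2 * c - 2) *
          ((c : RatFunc ℚ) * (RatFunc.X : RatFunc ℚ)⁻¹ ^ 2 + (2 + RatFunc.X ^ 2)) → False := by
      intro p hp
      have h1 : algebraMap ℚ[X] (RatFunc ℚ) (X ^ 2 * p) = algebraMap ℚ[X] (RatFunc ℚ)
          (2 * (c : ℚ[X]) * (2 + X ^ 2) ^ (2 * c - 2) * ((c : ℚ[X]) + X ^ 2 * (2 + X ^ 2))) := by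
        rw [map_mul, hp]
        simp only [map_mul, map_pow, map_add, RatFunc.algebraMap_X, map_ofNat, map_natCast]
        field_simp
      have h2 := congrArg (Polynomial.eval 0) (IsFractionRing.injective ℚ[X] (RatFunc ℚ) h1)
      have : c ≠ 0 := by omega
      simp [this] at h2
    rcases det_twoGroups c ((RatFunc.X : RatFunc ℚ)⁻¹ ^ 2) hb0 hc with h | h
    · exact key p (hp.trans h)
    · exact key (-p) (by rw [map_neg, hp, h, neg_neg])

/-- A table of distances of five points, the first two of which coincide: the vertices of a
quadruple with opposite edges of lengths `1`, `1`, `2`, one of them doubled. -/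
def doubledQuad : Matrix (Fin 5) (Fin 5) ℤ :=
  !![0, 0, 1, 1, 2;
     0, 0, 1, 1, 2;
     1, 1, 0, 2, 1;
     1, 1, 2, 0, 1;
     2, 2, 1, 1, 0]

/-- The edge between the two coinciding points of `doubledQuad`. -/
def doubledEdge : Matrix (Fin 5) (Fin 5) ℤ :=
  !![0, 1, 0, 0, 0;
     1, 0, 0, 0, 0;
     0, 0, 0, 0, 0;
     0, 0, 0, 0, 0;
     0, 0, 0, 0, 0]

theorem doubledQuad_transpose : doubledQuadᵀ = doubledQuad := by decide

theorem doubledEdge_transpose : doubledEdgeᵀ = doubledEdge := by decide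

theorem heron_doubledQuad (i j k : Fin 5) :
    heron (doubledQuad i j ^ 2) (doubledQuad j k ^ 2) (doubledQuad i k ^ 2) = 0 := by
  revert i j k
  decide

theorem doubledEdge_mul_doubledQuad (i j : Fin 5) : doubledEdge i j * doubledQuad i j = 0 := by
  revert i j
  decide

theorem det_doubledQuad {K : Type*} [Field K] (w : K) :
    (borderedMatrix fun i j => w * (doubledEdge i j : K) ^ 2 + (doubledQuad i j : K) ^ 2).det =
      256 * w := by
  rw [← Matrix.det_submatrix_equiv_self (finSuccEquiv 5)]
  have e0 : finSuccEquiv 5 0 = none := rfl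
  have e1 : finSuccEquiv 5 1 = some 0 := rfl
  have e2 : finSuccEquiv 5 2 = some 1 := rfl
  have e3 : finSuccEquiv 5 3 = some 2 := rfl
  have e4 : finSuccEquiv 5 4 = some 3 := rfl
  have e5 : finSuccEquiv 5 5 = some 4 := rfl
  have : (borderedMatrix fun i j => w * (doubledEdge i j : K) ^ 2 +
      (doubledQuad i j : K) ^ 2).submatrix (finSuccEquiv 5) (finSuccEquiv 5) =
    !![0, 1, 1, 1, 1, 1;
       1, 0, w, 1, 1, 4;
       1, w, 0, 1, 1, 4;
       1, 1, 1, 0, 4, 1;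
       1, 1, 1, 4, 0, 1;
       1, 4, 4, 1, 1, 0] := by
    ext i j
    fin_cases i <;> fin_cases j <;>
      simp [borderedMatrix, e0, e1, e2, e3, e4, e5, doubledEdge, doubledQuad] <;> norm_num
  rw [this]
  simp [Matrix.det_succ_row_zero, Fin.sum_univ_succ, Fin.succAbove]
  ring

/-- For five vertices, the lengths `X * doubledEdge + X⁻¹ * doubledQuad` give bounded areas, but
the volume has a pole at `X = 0`. -/
theorem not_isIntegral_four : ¬ IsIntegral (faceAlgebra 4 2) (simplexVolume 4) := by
  have hX : (RatFunc.X : RatFunc ℚ) ≠ 0 := RatFunc.X_ne_zero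
  have hsq : ∀ i j, (RatFunc.X * (doubledEdge i j : RatFunc ℚ) +
      RatFunc.X⁻¹ * (doubledQuad i j : RatFunc ℚ)) ^ 2 = RatFunc.X⁻¹ ^ 2 * (RatFunc.X ^ 4 *
        (doubledEdge i j : RatFunc ℚ) ^ 2 + (doubledQuad i j : RatFunc ℚ) ^ 2) := by
    intro i j
    have h : (doubledEdge i j : RatFunc ℚ) * (doubledQuad i j : RatFunc ℚ) = 0 := by
      exact_mod_cast congrArg (Int.cast (R := RatFunc ℚ)) (doubledEdge_mul_doubledQuad i j)
    field_simp
    linear_combination 2 * RatFunc.X ^ 2 * h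
  refine not_isIntegral_simplexVolume (Equiv.refl (Fin 5)) (x := fun i j =>
    RatFunc.X * (doubledEdge i j : RatFunc ℚ) + RatFunc.X⁻¹ * (doubledQuad i j : RatFunc ℚ))
    ?_ ?_ ?_ ?_
  · intro i j
    have h1 := congrFun (congrFun doubledEdge_transpose j) i
    have h2 := congrFun (congrFun doubledQuad_transpose j) i
    simp only [transpose_apply] at h1 h2
    simp only [h1, h2]
  · intro i
    have h1 : ∀ i, doubledEdge i i = 0 := by decide
    have h2 : ∀ i, doubledQuad i i = 0 := by decide
    simp [h1, h2]
  · intro i j k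
    have h : heron ((doubledQuad i j : RatFunc ℚ) ^ 2) ((doubledQuad j k : RatFunc ℚ) ^ 2)
        ((doubledQuad i k : RatFunc ℚ) ^ 2) = 0 := by
      have := congrArg (Int.cast (R := RatFunc ℚ)) (heron_doubledQuad i j k)
      simp only [heron] at this ⊢
      exact_mod_cast this
    simp only [hsq]
    have main : ∀ e₁ e₂ e₃ s₁ s₂ s₃ : RatFunc ℚ, heron (s₁ ^ 2) (s₂ ^ 2) (s₃ ^ 2) = 0 →
        heron (RatFunc.X⁻¹ ^ 2 * (RatFunc.X ^ 4 * e₁ ^ 2 + s₁ ^ 2))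
          (RatFunc.X⁻¹ ^ 2 * (RatFunc.X ^ 4 * e₂ ^ 2 + s₂ ^ 2))
          (RatFunc.X⁻¹ ^ 2 * (RatFunc.X ^ 4 * e₃ ^ 2 + s₃ ^ 2)) =
        RatFunc.X ^ 4 * heron (e₁ ^ 2) (e₂ ^ 2) (e₃ ^ 2) +
          2 * (e₁ ^ 2 * (s₂ ^ 2 + s₃ ^ 2 - s₁ ^ 2) + e₂ ^ 2 * (s₁ ^ 2 + s₃ ^ 2 - s₂ ^ 2) +
            e₃ ^ 2 * (s₁ ^ 2 + s₂ ^ 2 - s₃ ^ 2)) := by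
      intro e₁ e₂ e₃ s₁ s₂ s₃ hs
      simp only [heron] at hs ⊢
      field_simp
      linear_combination hs
    rw [main _ _ _ _ _ _ h]
    have hx : (RatFunc.X : RatFunc ℚ) ∈ (algebraMap ℚ[X] (RatFunc ℚ)).range :=
      ⟨X, RatFunc.algebraMap_X⟩
    have hz : ∀ z : ℤ, (z : RatFunc ℚ) ∈ (algebraMap ℚ[X] (RatFunc ℚ)).range :=
      fun z => intCast_mem _ z
    have hw : ∀ z : ℤ, RatFunc.X ^ 4 * (z : RatFunc ℚ) ∈ (algebraMap ℚ[X] (RatFunc ℚ)).range :=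
      fun z => mul_mem (pow_mem hx 4) (hz z)
    convert add_mem (hw (heron (doubledEdge i j ^ 2) (doubledEdge j k ^ 2) (doubledEdge i k ^ 2)))
      (hz (2 * (doubledEdge i j ^ 2 * (doubledQuad j k ^ 2 + doubledQuad i k ^ 2 -
        doubledQuad i j ^ 2) + doubledEdge j k ^ 2 * (doubledQuad i j ^ 2 + doubledQuad i k ^ 2 -
        doubledQuad j k ^ 2) + doubledEdge i k ^ 2 * (doubledQuad i j ^ 2 + doubledQuad j k ^ 2 -
        doubledQuad i k ^ 2)))) using 1
    simp only [heron]
    push_cast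
    ring
  · rintro ⟨p, hp⟩
    simp only [hsq] at hp
    have h1 := mul_det_borderedMatrix_mul ((RatFunc.X : RatFunc ℚ)⁻¹ ^ 2) fun i j =>
      RatFunc.X ^ 4 * (doubledEdge i j : RatFunc ℚ) ^ 2 + (doubledQuad i j : RatFunc ℚ) ^ 2
    rw [← hp, det_doubledQuad, Fintype.card_fin] at h1
    have h2 : algebraMap ℚ[X] (RatFunc ℚ) (X ^ 4 * p) = algebraMap ℚ[X] (RatFunc ℚ) 256 := by
      rw [map_mul, map_pow, map_ofNat, RatFunc.algebraMap_X]
      field_simp at h1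
      linear_combination h1
    have h3 := congrArg (Polynomial.eval 0) (IsFractionRing.injective ℚ[X] (RatFunc ℚ) h2)
    have h4 : Polynomial.eval 0 (256 : ℚ[X]) = 256 := Polynomial.eval_ofNat 256 0
    rw [h4] at h3
    simp at h3

end Obstructions

/-! ### The criterion for integrality and its formulation by a monic relation -/

theorem isIntegral_simplexVolume_iff {n : ℕ} (hn : 3 ≤ n) :
    IsIntegral (faceAlgebra n 2) (simplexVolume n) ↔ Even n ∧ 6 ≤ n := by
  refine ⟨fun h => ?_, fun h => isIntegral_simplexVolume h.1 h.2⟩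
  have heven : Even n := by
    by_contra hodd
    exact not_isIntegral_of_odd (Nat.not_even_iff_odd.mp hodd) h
  refine ⟨heven, ?_⟩
  by_contra hlt
  obtain rfl : n = 4 := by
    obtain ⟨r, rfl⟩ := heven
    omega
  exact not_isIntegral_four h

/-- Integrality over the image of a polynomial ring as a monic relation. -/
theorem isIntegral_adjoin_range_iff {k K σ : Type*} [Field k] [Field K] [Algebra k K] (v : σ → K)
    (x : K) : IsIntegral (Algebra.adjoin k (Set.range v)) x ↔
      ∃ (N : ℕ) (a : Fin N → MvPolynomial σ k),
        x ^ N + ∑ i : Fin N, MvPolynomial.aeval v (a i) * x ^ (i : ℕ) = 0 := by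
  constructor
  · rintro ⟨p, hp, hp0⟩
    have hmem : ∀ i, ∃ f : MvPolynomial σ k, MvPolynomial.aeval v f = (p.coeff i : K) := fun i =>
      (SetLike.ext_iff.mp (Algebra.adjoin_range_eq_range_aeval k v) _).mp (p.coeff i).2
    choose f hf using hmem
    refine ⟨p.natDegree, fun i => f i, ?_⟩
    rw [Polynomial.eval₂_eq_sum_range, Finset.sum_range_succ, hp.coeff_natDegree, map_one, one_mul,
      add_comm, Finset.sum_range] at hp0
    simp only [hf]
    exact hp0
  · rintro ⟨N, a, h⟩
    have hmem : ∀ i, MvPolynomial.aeval v (a i) ∈ Algebra.adjoin k (Set.range v) := fun i => by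
      rw [Algebra.adjoin_range_eq_range_aeval]
      exact ⟨a i, rfl⟩
    let c : Fin N → Algebra.adjoin k (Set.range v) := fun i => ⟨_, hmem i⟩
    refine ⟨Polynomial.X ^ N + ∑ i : Fin N, Polynomial.C (c i) * Polynomial.X ^ (i : ℕ),
      Polynomial.monic_X_pow_add (Polynomial.degree_sum_fin_lt c), ?_⟩
    rw [← h]
    simp only [Polynomial.eval₂_add, Polynomial.eval₂_X_pow, Polynomial.eval₂_finsetSum,
      Polynomial.eval₂_mul, Polynomial.eval₂_C]
    rfl

end SimplexVolume

end

theorem mainTheorem1 (n : ℕ) (hn : 3 ≤ n) :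
    (IsIntegral (SimplexVolume.faceAlgebra n 2) (SimplexVolume.simplexVolume n) ↔
      Even n ∧ 6 ≤ n) ∧
    ((∃ (N : ℕ) (a : Fin N → MvPolynomial (SimplexVolume.Face n 2) ℚ),
        SimplexVolume.simplexVolume n ^ N +
          ∑ i : Fin N, MvPolynomial.aeval
            (fun F : SimplexVolume.Face n 2 => SimplexVolume.volume F) (a i) *
              SimplexVolume.simplexVolume n ^ (i : ℕ) = 0) ↔
      Even n ∧ 6 ≤ n) := by
  have h := SimplexVolume.isIntegral_simplexVolume_iff hn
  exact ⟨h, (SimplexVolume.isIntegral_adjoin_range_iff _ _).symm.trans h⟩
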